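/- Let $k$ be an algebraically closed field of characteristic $0$ and let $R=k[[x_1,\dots,x_n]]\subseteq k[[t]]$ with $x_i=\alpha_i t^{a_i}$, where the $\alpha_i$ are units of $k[[t]]$ and $0<a_1<\dots<a_n$. Assume that $k[[t]]$ is the integral closure of $R$ in its fraction field $k((t))$ and that $R$ has embedding dimension $n$. Let $v(R)$ be the set of orders in $t$ of the nonzero elements of $R$, let $\mathfrak C_R=\{r\in R: r\,k[[t]]\subseteq R\}=t^{c}k[[t]]$ be the conductor of $R$, and assume $\mathfrak C_R\subseteq\mathfrak m_R^2$. Let $b_1<\dots<b_s$ be the elements of $\{c-a_1,\dots,c-1\}\setminus v(R)$, put $T_j=t^{b_j}$, and let $S=R[\mathfrak C_R/x_1]$, where $\mathfrak C_R/x_1=\{y\in k[[t]]: x_1y\in\mathfrak C_R\}$. Then $S=R[T_1,\dots,T_s]$, and there is a surjective $k$-algebra homomorphism $\Phi:k[[X_1,\dots,X_n,T_1,\dots,T_s]]\to S$ with $X_i\mapsto x_i$ and $T_j\mapsto t^{b_j}$. Let $\Omega_S$ be the universally finite module of differentials of $S$ over $k$, that is, the cokernel of the Jacobian matrix of $\ker\Phi$,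 with basis $dx_1,\dots,dx_n,dT_1,\dots,dT_s$ of the free module $S^{n+s}$ that presents it, and let $\tau(\Omega_S)$ be its torsion submodule. Then the length $\lambda$ over $S$ satisfies $$\lambda(\tau(\Omega_S))\ \ge\ ns+\binom s2 .$$ More precisely, for all $1\le i\le n$ and $1\le j\le s$ there are a power series $f_{ij}\in(X_1,\dots,X_n)\subseteq k[[X_1,\dots,X_n]]$ and scalars $\delta_{ijl}\in k$ $(1\le l\le s)$, with $\delta_{ijl}=0$ for $l\le j$, such that the elements $$[x_i,T_j]=b_j\Big(T_j+f_{ij}(x)+\sum_{l=1}^s\delta_{ijl}T_l\Big)dx_i-a_ix_i\Big(dT_j+\sum_{u=1}^n\frac{\partial f_{ij}}{\partial X_u}(x)\,dx_u+\sum_{l=1}^s\delta_{ijl}\,dT_l\Big)$$ and $$\Gamma_{ij}=b_jT_j\,dT_i-b_iT_i\,dT_j\qquad(1\le i,j\le s)$$ of $\Omega_S$ all lie in $\tau(\Omega_S)$, and the $ns+\binom s2$ elements $[x_i,T_j]$ $(1\le i\le n,\ 1\le j\le s)$ and $\Gamma_{ij}$ $(1\le i<j\le s)$ together are linearly independent over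 $k$. -/

import Mathlib

open scoped PowerSeries

noncomputable section

namespace CurveTorsion

variable {k : Type*} [Field k]

/-- The continuous `k`-algebra homomorphism `k⟦Y_i : i ∈ ι⟧ → k⟦t⟧`, `Y_i ↦ y_i`, for power series
`y_i` without constant term. -/
def evalHom {ι : Type*} [Finite ι] (y : ι → k⟦X⟧)
    (hy : ∀ i, PowerSeries.constantCoeff (y i) = 0) : MvPowerSeries ι k →ₐ[k] k⟦X⟧ :=
  MvPowerSeries.substAlgHom (MvPowerSeries.hasSubst_of_constantCoeff_zero hy)

/-- The ring `k⟦y_i : i ∈ ι⟧ ⊆ k⟦t⟧` of all power series in the `y_i`. -/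
def curveRing {ι : Type*} [Finite ι] (y : ι → k⟦X⟧)
    (hy : ∀ i, PowerSeries.constantCoeff (y i) = 0) : Subalgebra k k⟦X⟧ :=
  (evalHom y hy).range

instance {ι : Type*} [Finite ι] (y : ι → k⟦X⟧)
    (hy : ∀ i, PowerSeries.constantCoeff (y i) = 0) : IsLocalRing (curveRing y hy) :=
  IsLocalRing.of_surjective' (evalHom y hy).rangeRestrict.toRingHom
    (evalHom y hy).rangeRestrict_surjective

/-- The value semigroup `v(R)` of `R ⊆ k⟦t⟧`: the orders of the nonzero elements of `R`. -/
def valueSet (R : Subalgebra k k⟦X⟧) : Set ℕ :=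
  {m | ∃ r ∈ R, PowerSeries.order r = m}

/-- The conductor `𝔠_R = R : k⟦t⟧` of `R ⊆ k⟦t⟧`, as an ideal of `R`. -/
def conductorIdeal (R : Subalgebra k k⟦X⟧) : Ideal R where
  carrier := {r | ∀ f : k⟦X⟧, (r : k⟦X⟧) * f ∈ R}
  add_mem' {p q} hp hq f := by
    simpa [add_mul] using R.add_mem (hp f) (hq f)
  zero_mem' f := by simp
  smul_mem' p q hq f := by
    simpa [mul_assoc] using R.mul_mem p.2 (hq f)

/-- `c_R`, the least order of an element of the conductor. -/
def conductorExp (R : Subalgebra k k⟦X⟧) : ℕ :=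
  sInf {m | ∃ r ∈ conductorIdeal R, PowerSeries.order (r : k⟦X⟧) = m}

/-- The ring `R[𝔠_R / x]`: the elements adjoined to `R` are the `y = c / x` with `c ∈ 𝔠_R`. -/
def conductorExtension (R : Subalgebra k k⟦X⟧) (x : k⟦X⟧) : Subalgebra k k⟦X⟧ :=
  (Algebra.adjoin R {y : k⟦X⟧ | ∃ c ∈ conductorIdeal R, x * y = c}).restrictScalars k

section Omega

variable {ι S : Type*} [CommRing S] [Algebra k S]

/-- The submodule of `S^ι` generated by the columns of the Jacobian matrix of the ideal `ker Φ`
of `k⟦Y_i : i ∈ ι⟧`, with entries taken in `S`. -/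
def jacobianSubmodule (Φ : MvPowerSeries ι k →ₐ[k] S) : Submodule S (ι → S) :=
  Submodule.span S
    {v | ∃ g : MvPowerSeries ι k, Φ g = 0 ∧ v = fun i => Φ (MvPowerSeries.pderiv k i g)}

/-- The universally finite module of differentials `Ω_S` of `S = k⟦Y⟧ / ker Φ`, for a surjection
`Φ : k⟦Y⟧ → S` in finitely many variables: the cokernel of the Jacobian matrix of `ker Φ`. -/
abbrev Omega (Φ : MvPowerSeries ι k →ₐ[k] S) : Type _ :=
  (ι → S) ⧸ jacobianSubmodule Φ

/-- The class in `Ω_S` of the column vector `v`, that is, `∑ i, v i • d(Y i)`. -/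
def Omega.mk (Φ : MvPowerSeries ι k →ₐ[k] S) (v : ι → S) : Omega Φ :=
  (jacobianSubmodule Φ).mkQ v

/-- The differential `d(Y i)` in `Ω_S`. -/
def Omega.d [DecidableEq ι] (Φ : MvPowerSeries ι k →ₐ[k] S) (i : ι) : Omega Φ :=
  Omega.mk Φ (Pi.single i 1)

end Omega

section Elements

variable {S : Type*} [CommRing S] [Algebra k S] {n s : ℕ}

/-- The element `[x_i, T_j]` of `Ω_S`, written as a column vector with respect to
`dx_1, …, dx_n, dT_1, …, dT_s`. With `w = T_j + f(x) + ∑ l, δ_l T_l` it is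
`b_j w dx_i - a_i x_i dw`. -/
def bracket (Φ : MvPowerSeries (Fin n ⊕ Fin s) k →ₐ[k] S) (a : Fin n → ℕ) (b : Fin s → ℕ)
    (i : Fin n) (j : Fin s) (f : MvPowerSeries (Fin n) k) (δ : Fin s → k) : Omega Φ :=
  let x : Fin n → S := fun u => Φ (MvPowerSeries.X (Sum.inl u))
  let T : Fin s → S := fun l => Φ (MvPowerSeries.X (Sum.inr l))
  let ev : MvPowerSeries (Fin n) k → S := fun g => Φ (MvPowerSeries.rename Sum.inl g)
  Omega.mk Φ (Sum.elim
    (fun u => (if u = i then (b j : S) * (T j + ev f + ∑ l, δ l • T l) else 0)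
      - (a i : S) * x i * ev (MvPowerSeries.pderiv k u f))
    (fun l => - ((a i : S) * x i * ((if l = j then 1 else 0) + algebraMap k S (δ l)))))

/-- The element `Γ_{ij} = b_j T_j dT_i - b_i T_i dT_j` of `Ω_S`. -/
def Gam (Φ : MvPowerSeries (Fin n ⊕ Fin s) k →ₐ[k] S) (b : Fin s → ℕ) (i j : Fin s) : Omega Φ :=
  ((b j : S) * Φ (MvPowerSeries.X (Sum.inr j))) • Omega.d Φ (Sum.inr i)
    - ((b i : S) * Φ (MvPowerSeries.X (Sum.inr i))) • Omega.d Φ (Sum.inr j)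

end Elements

end CurveTorsion

end

noncomputable section

namespace CurveTorsion

variable {k : Type*} [Field k]

/-! ### Substituting series without constant term -/

section Eval

variable {ι : Type*} [Finite ι] (y : ι → k⟦X⟧) (hy : ∀ i, PowerSeries.constantCoeff (y i) = 0)

/-! Torsion. The chain rule (`derivative_evalHom`) sends a differential form to `k⟦t⟧ dt`, and every
form in the kernel is torsion (`mk_mem_torsion`): each generator is algebraic over `k⟦x_1⟧`, so in
characteristic zero a nonzero multiple of its differential is a multiple of `dx_1`. If `w` is the
normalised power `x_i ^ (b_j / a_i)`, then `b_j w dx_i - a_i x_i dw` maps to zero. This `w` is `t ^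
b_j` plus terms of higher order, and modulo `R` those reduce to monomials `T_l` with `l > j`
(`exists_reduction`); this yields `f_ij` and the triangular `δ`. The `Γ_ij` vanish in `k⟦t⟧ dt`
because the `T_j` are monomials.

Independence. The presentation of `S` is minimal
(`constantCoeff_pderiv_eq_zero_of_evalHom_eq_zero`): a product of some `T_l` with a noninvertible
element lies in the conductor, hence in `m_R ^ 2`; the exponents of the `T_l` are not values of `R`,
and the `x_i` are independent modulo `m_R ^ 2`. So a relation among forms with coefficients in the
maximal ideal equates, to first order, a combination of their coefficient vectors with a gradient.
The Jacobian of a gradient at the origin is a Hessian, hence symmetric (`sum_antisymm_eq_zero`). The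
antisymmetric parts of the given forms are triangular with diagonal entries `a_i + b_j` and `b_i +
b_j`, so all coefficients of a relation have zero constant term
(`constantCoeff_eq_zero_of_relation`). This gives independence over `k` and, through
`card_le_length`, the bound on the length. -/

theorem evalHom_X (i : ι) : evalHom y hy (MvPowerSeries.X i) = y i :=
  MvPowerSeries.substAlgHom_X _ i

theorem evalHom_coe (p : MvPolynomial ι k) : evalHom y hy p = MvPolynomial.aeval y p :=
  MvPowerSeries.substAlgHom_coe _ p

theorem evalHom_C (r : k) : evalHom y hy (MvPowerSeries.C r) = PowerSeries.C r :=
  (evalHom y hy).commutes r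

/-- Each `y i` has order at least one, so substitution cannot lower the order. This estimate
replaces continuity: identities are checked on polynomial truncations, modulo every `X ^ N`. -/
theorem X_pow_dvd_evalHom {N : ℕ} {g : MvPowerSeries ι k}
    (hg : ∀ e, e.degree < N → MvPowerSeries.coeff e g = 0) :
    PowerSeries.X ^ N ∣ evalHom y hy g := by
  have h1 : (N : ℕ∞) ≤ g.order := MvPowerSeries.nat_le_order hg
  have h2 := MvPowerSeries.le_order_subst
    (MvPowerSeries.hasSubst_of_constantCoeff_zero hy) g
  have h3 : (1 : ℕ∞) ≤ ⨅ i, MvPowerSeries.order (y i) :=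
    le_iInf fun i => MvPowerSeries.one_le_order_iff_constCoeff_eq_zero.2 (hy i)
  have h4 : (N : ℕ∞) ≤ MvPowerSeries.order (evalHom y hy g) := by
    refine le_trans ?_ (h2.trans_eq (congrArg MvPowerSeries.order
      (MvPowerSeries.substAlgHom_apply _ g).symm))
    calc (N : ℕ∞) = 1 * N := (one_mul _).symm
      _ ≤ _ := mul_le_mul' h3 h1
  rw [PowerSeries.X_pow_dvd_iff]
  intro m hm
  refine MvPowerSeries.coeff_of_lt_order (lt_of_lt_of_le ?_ h4)
  simpa using hm

/-- A power series in the `y i` agrees with its truncation to high order. -/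
theorem X_pow_dvd_evalHom_sub_truncTotal (N : ℕ) (g : MvPowerSeries ι k) :
    PowerSeries.X ^ N ∣ evalHom y hy g - MvPolynomial.aeval y (g.truncTotal N) := by
  rw [← evalHom_coe y hy, ← map_sub]
  refine X_pow_dvd_evalHom y hy fun e he => ?_
  rw [map_sub, MvPolynomial.coeff_coe, MvPowerSeries.coeff_truncTotal _ he, sub_self]

/-- If a subspace contains all series of high order and all monomials in the `y i` that occur in
`g`, then it contains `g(y)`. -/
theorem evalHom_mem (W : Submodule k k⟦X⟧) (N : ℕ)
    (hW : ∀ f : k⟦X⟧, PowerSeries.X ^ N ∣ f → f ∈ W) {g : MvPowerSeries ι k}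
    (hg : ∀ e, MvPowerSeries.coeff e g ≠ 0 → (e.prod fun i m => y i ^ m) ∈ W) :
    evalHom y hy g ∈ W := by
  have h1 := hW _ (X_pow_dvd_evalHom_sub_truncTotal y hy N g)
  have h2 : MvPolynomial.aeval y (g.truncTotal N) ∈ W := by
    rw [MvPolynomial.aeval_def, MvPolynomial.eval₂_eq]
    refine W.sum_mem fun e he => ?_
    have he' : MvPowerSeries.coeff e g ≠ 0 := by
      intro h0
      rw [MvPolynomial.mem_support_iff, MvPowerSeries.coeff_truncTotal_eq_ite, h0] at he
      simp at he
    rw [← Algebra.smul_def]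
    exact W.smul_mem _ (hg e he')
  simpa using W.add_mem h1 h2

/-- The subspace of power series divisible by `X ^ N`. -/
def orderGE (k : Type*) [Field k] (N : ℕ) : Submodule k k⟦X⟧ :=
  (Ideal.span {(PowerSeries.X : k⟦X⟧) ^ N}).restrictScalars k

theorem mem_orderGE {N : ℕ} {f : k⟦X⟧} : f ∈ orderGE k N ↔ PowerSeries.X ^ N ∣ f :=
  Ideal.mem_span_singleton

theorem eq_zero_of_forall_X_pow_dvd {f : k⟦X⟧} (h : ∀ N, PowerSeries.X ^ N ∣ f) : f = 0 := by
  ext m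
  exact PowerSeries.X_pow_dvd_iff.1 (h (m + 1)) m (Nat.lt_succ_self m)

theorem constantCoeff_evalHom (g : MvPowerSeries ι k) :
    PowerSeries.constantCoeff (evalHom y hy g) = MvPowerSeries.constantCoeff g := by
  have h : PowerSeries.X ^ 1 ∣
      evalHom y hy (g - MvPowerSeries.C (MvPowerSeries.constantCoeff g)) := by
    refine X_pow_dvd_evalHom y hy fun e he => ?_
    have : e = 0 := (Finsupp.degree_eq_zero_iff e).1 (by omega)
    subst this
    simp
  rw [pow_one, PowerSeries.X_dvd_iff, map_sub, map_sub, evalHom_C] at h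
  simpa [sub_eq_zero] using h

theorem X_pow_dvd_derivative {N : ℕ} {f : k⟦X⟧} (h : PowerSeries.X ^ (N + 1) ∣ f) :
    PowerSeries.X ^ N ∣ PowerSeries.derivative k f := by
  rw [PowerSeries.X_pow_dvd_iff] at h ⊢
  intro m hm
  rw [PowerSeries.coeff_derivative, h (m + 1) (by omega), zero_mul]

/-- The chain rule for the substitution of power series in one variable. -/
theorem derivative_evalHom {ι : Type*} [Fintype ι] (y : ι → k⟦X⟧)
    (hy : ∀ i, PowerSeries.constantCoeff (y i) = 0) (g : MvPowerSeries ι k) :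
    PowerSeries.derivative k (evalHom y hy g) =
      ∑ i, evalHom y hy (MvPowerSeries.pderiv k i g) * PowerSeries.derivative k (y i) := by
  classical
  have hpoly : ∀ p : MvPolynomial ι k, PowerSeries.derivative k (evalHom y hy p) =
      ∑ i, evalHom y hy (MvPowerSeries.pderiv k i p) * PowerSeries.derivative k (y i) := by
    intro p
    simp only [MvPowerSeries.pderiv_coe, evalHom_coe]
    induction p using MvPolynomial.induction_on with
    | C a => simp
    | add p q hp hq => simp [hp, hq, add_mul, Finset.sum_add_distrib]
    | mul_X p i hp =>
      simp only [map_mul, MvPolynomial.aeval_X, Derivation.leibniz, hp, smul_eq_mul,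
        MvPolynomial.pderiv_X, map_add, add_mul, Finset.sum_add_distrib, Finset.mul_sum]
      congr 1
      · rw [Finset.sum_eq_single i]
        · simp
        · intro b _ hb
          simp [hb.symm]
        · simp
      · exact Finset.sum_congr rfl fun j _ => by ring
  rw [← sub_eq_zero]
  refine eq_zero_of_forall_X_pow_dvd fun N => ?_
  -- The truncation is at `N + 1` because differentiation loses one degree.
  set p : MvPowerSeries ι k := MvPolynomial.toMvPowerSeries (g.truncTotal (N + 1)) with hp
  have hr : ∀ e, e.degree < N + 1 → MvPowerSeries.coeff e (g - p) = 0 := fun e he => by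
    rw [map_sub, hp, MvPolynomial.coeff_coe, MvPowerSeries.coeff_truncTotal _ he, sub_self]
  have key : PowerSeries.derivative k (evalHom y hy g) -
      ∑ i, evalHom y hy (MvPowerSeries.pderiv k i g) * PowerSeries.derivative k (y i) =
      PowerSeries.derivative k (evalHom y hy (g - p)) -
      ∑ i, evalHom y hy (MvPowerSeries.pderiv k i (g - p)) * PowerSeries.derivative k (y i) := by
    simp only [map_sub, sub_mul, Finset.sum_sub_distrib, hp, hpoly]
    ring
  rw [key]
  refine dvd_sub (X_pow_dvd_derivative (X_pow_dvd_evalHom y hy hr))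
    (Finset.dvd_sum fun i _ => Dvd.dvd.mul_right (X_pow_dvd_evalHom y hy fun e he => ?_) _)
  rw [MvPowerSeries.coeff_pderiv, hr, zero_mul]
  simpa using he

theorem evalHom_rename {κ : Type*} [Finite κ] (φ : κ → ι) (g : MvPowerSeries κ k) :
    evalHom y hy (MvPowerSeries.rename φ g) = evalHom (y ∘ φ) (fun i => hy (φ i)) g := by
  have hs := MvPowerSeries.hasSubst_of_constantCoeff_zero hy
  have h1 : evalHom y hy (MvPowerSeries.rename φ g) =
      MvPowerSeries.subst y (MvPowerSeries.rename φ g) := MvPowerSeries.substAlgHom_apply _ _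
  have h2 : evalHom (y ∘ φ) (fun i => hy (φ i)) g = MvPowerSeries.subst (y ∘ φ) g :=
    MvPowerSeries.substAlgHom_apply _ _
  rw [h1, h2, MvPowerSeries.rename_eq_subst, MvPowerSeries.subst_comp_subst_apply
    (MvPowerSeries.HasSubst.X_comp φ) hs]
  congr 1
  funext i
  exact MvPowerSeries.subst_X hs (φ i)

end Eval

/-! ### `k⟦t⟧` as a finite module over `k⟦z⟧` -/

section OneVariable

/-- Expansion of a power series along a sequence with strictly increasing orders. -/
theorem exists_expansion (e : ℕ → k⟦X⟧) (he : ∀ m, PowerSeries.X ^ m ∣ e m)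
    (he0 : ∀ m, PowerSeries.coeff m (e m) ≠ 0) (f : k⟦X⟧) :
    ∃ c : ℕ → k, ∀ N, PowerSeries.X ^ N ∣ f - ∑ m ∈ Finset.range N, c m • e m := by
  -- Successive remainders: the multiple of `e m` subtracted at stage `m` cancels the coefficient of
  -- degree `m`.
  let r : ℕ → k⟦X⟧ := fun m => Nat.rec f
    (fun m g => g - (PowerSeries.coeff m g / PowerSeries.coeff m (e m)) • e m) m
  refine ⟨fun m => PowerSeries.coeff m (r m) / PowerSeries.coeff m (e m), fun N => ?_⟩
  have h : ∀ N, f - ∑ m ∈ Finset.range N,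
      (PowerSeries.coeff m (r m) / PowerSeries.coeff m (e m)) • e m = r N := fun N => by
    induction N with
    | zero => simp [r]
    | succ N ih => rw [Finset.sum_range_succ, ← sub_sub, ih]
  rw [h]
  induction N with
  | zero => simp
  | succ N ih =>
    change _ ∣ r N - (PowerSeries.coeff N (r N) / PowerSeries.coeff N (e N)) • e N
    rw [PowerSeries.X_pow_dvd_iff] at ih ⊢
    intro m hm
    rcases Nat.lt_succ_iff_lt_or_eq.1 hm with h | rfl
    · simp [ih m h, PowerSeries.X_pow_dvd_iff.1 (he N) m h]
    · simp [he0 m]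

theorem _root_.RingHom.finite_of_forall_eq_sum {A B ι : Type*} [CommRing A] [CommRing B]
    (φ : A →+* B) (e : ι → B) (s : Finset ι)
    (h : ∀ b, ∃ c : ι → A, b = ∑ i ∈ s, φ (c i) * e i) : φ.Finite := by
  classical
  let _ := φ.toAlgebra
  refine Module.Finite.of_fg_top ⟨s.image e, ?_⟩
  rw [eq_top_iff]
  intro b _
  obtain ⟨c, rfl⟩ := h b
  refine Submodule.sum_mem _ fun i hi => ?_
  exact Submodule.smul_mem _ (c i) (Submodule.subset_span
    (Finset.mem_coe.2 (Finset.mem_image_of_mem _ hi)))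

/-- Substitution of one power series `z` without constant term. -/
abbrev evalOne (z : k⟦X⟧) (hz : PowerSeries.constantCoeff z = 0) : k⟦X⟧ →ₐ[k] k⟦X⟧ :=
  evalHom (fun _ : Unit => z) fun _ => hz

variable {z : k⟦X⟧} (hz : PowerSeries.constantCoeff z = 0)

theorem evalOne_X : evalOne z hz PowerSeries.X = z := evalHom_X _ _ ()

theorem X_pow_dvd_evalOne {N : ℕ} {g : k⟦X⟧} (hg : PowerSeries.X ^ N ∣ g) :
    PowerSeries.X ^ N ∣ evalOne z hz g := by
  obtain ⟨h, rfl⟩ := hg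
  rw [map_mul, map_pow, evalOne_X]
  exact Dvd.dvd.mul_right (pow_dvd_pow_of_dvd (PowerSeries.X_dvd_iff.2 hz) N) _

/-- A nonzero series is a power of `X` times a series with nonzero constant term; the image is the
same power of `z` times such a series. -/
theorem evalOne_injective (hz0 : z ≠ 0) : Function.Injective (evalOne z hz) := by
  rw [injective_iff_map_eq_zero]
  intro g hg
  by_contra h0
  rw [← PowerSeries.X_pow_order_mul_divXPowOrder (f := g), map_mul, map_pow, evalOne_X] at hg
  rcases mul_eq_zero.1 hg with h | h
  · exact hz0 (eq_zero_of_pow_eq_zero h)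
  · have h1 := constantCoeff_evalHom (fun _ : Unit => z) (fun _ => hz) g.divXPowOrder
    rw [h, map_zero] at h1
    exact (PowerSeries.constantCoeff_divXPowOrder_eq_zero_iff.not.2 h0) h1.symm

/-- `k⟦X⟧` is generated by `1, X, …, X ^ (a - 1)` over `k⟦z⟧` when `z` has order `a`. -/
theorem exists_eq_sum_evalOne {a : ℕ} (hza : PowerSeries.X ^ a ∣ z)
    (hza0 : PowerSeries.coeff a z ≠ 0) (f : k⟦X⟧) :
    ∃ h : ℕ → k⟦X⟧, f = ∑ i ∈ Finset.range a, evalOne z hz (h i) * PowerSeries.X ^ i := by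
  have ha : 0 < a := by
    rcases Nat.eq_zero_or_pos a with rfl | h
    · exact absurd (by simpa using hz) hza0
    · exact h
  obtain ⟨u, rfl⟩ := hza
  have hu : PowerSeries.constantCoeff u ≠ 0 := by
    simpa [PowerSeries.coeff_X_pow_mul'] using hza0
  set z := PowerSeries.X ^ a * u with hzdef
  -- Division with remainder by `a` gives, for every `m`, a product of order exactly `m` in which
  -- `X` occurs to a power below `a`.
  have hem : ∀ m, z ^ (m / a) * PowerSeries.X ^ (m % a) =
      PowerSeries.X ^ m * u ^ (m / a) := fun m => by
    rw [hzdef, mul_pow, ← pow_mul, mul_right_comm, ← pow_add, Nat.div_add_mod]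
  obtain ⟨c, hc⟩ := exists_expansion (fun m => z ^ (m / a) * PowerSeries.X ^ (m % a))
    (fun m => by simp only [hem]; exact dvd_mul_right _ _)
    (fun m => by
      simp only [hem]
      rw [PowerSeries.coeff_X_pow_mul', if_pos le_rfl, Nat.sub_self]
      simpa using fun h => absurd h hu) f
  -- The coefficient of `X ^ i` collects the expansion terms with index congruent to `i` modulo `a`.
  refine ⟨fun i => PowerSeries.mk fun q => c (q * a + i), ?_⟩
  rw [← sub_eq_zero]
  refine eq_zero_of_forall_X_pow_dvd fun N => ?_
  have h1 : ∀ i, PowerSeries.X ^ N ∣ evalOne z hz (PowerSeries.mk fun q => c (q * a + i)) -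
      ∑ q ∈ Finset.range N, c (q * a + i) • z ^ q := fun i => by
    have h := X_pow_dvd_evalOne hz (N := N) (g := (PowerSeries.mk fun q => c (q * a + i)) -
      ∑ q ∈ Finset.range N, c (q * a + i) • PowerSeries.X ^ q) (by
        rw [PowerSeries.X_pow_dvd_iff]
        intro m hm
        simp [PowerSeries.coeff_X_pow, hm])
    simpa only [map_sub, map_sum, map_smul, map_pow, evalOne_X] using h
  have h2 : ∀ M, ∑ m ∈ Finset.range (M * a), c m • (z ^ (m / a) * PowerSeries.X ^ (m % a)) =
      ∑ i ∈ Finset.range a, (∑ q ∈ Finset.range M, c (q * a + i) • z ^ q) * PowerSeries.X ^ i := by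
    intro M
    induction M with
    | zero => simp
    | succ M ih =>
      rw [add_mul, one_mul, Finset.sum_range_add, ih, ← Finset.sum_add_distrib]
      refine Finset.sum_congr rfl fun i hi => ?_
      have hi' : i < a := Finset.mem_range.1 hi
      rw [Finset.sum_range_succ, add_mul, mul_comm M a, Nat.mul_add_div ha,
        Nat.div_eq_of_lt hi', Nat.mul_add_mod, Nat.mod_eq_of_lt hi', add_zero, smul_mul_assoc,
        mul_comm a M]
  have h3 := (pow_dvd_pow PowerSeries.X (Nat.le_mul_of_pos_right N ha)).trans (hc (N * a))
  rw [h2] at h3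
  have h4 : f - ∑ i ∈ Finset.range a,
      evalOne z hz (PowerSeries.mk fun q => c (q * a + i)) * PowerSeries.X ^ i =
      (f - ∑ i ∈ Finset.range a,
        (∑ q ∈ Finset.range N, c (q * a + i) • z ^ q) * PowerSeries.X ^ i) -
      ∑ i ∈ Finset.range a, (evalOne z hz (PowerSeries.mk fun q => c (q * a + i)) -
        ∑ q ∈ Finset.range N, c (q * a + i) • z ^ q) * PowerSeries.X ^ i := by
    simp only [sub_mul, Finset.sum_sub_distrib]
    ring
  rw [h4]
  exact dvd_sub h3 (Finset.dvd_sum fun i _ => (h1 i).mul_right _)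

theorem evalOne_isIntegral (hz0 : z ≠ 0) : (evalOne z hz).toRingHom.IsIntegral := by
  apply RingHom.Finite.to_isIntegral
  refine RingHom.finite_of_forall_eq_sum _ (PowerSeries.X ^ ·) (Finset.range z.order.toNat) ?_
  exact exists_eq_sum_evalOne hz (PowerSeries.X_pow_order_dvd (φ := z))
    (PowerSeries.coeff_order hz0)

end OneVariable

/-! ### Separable relations between the generators -/

/-- Every element integral over the image of an injective homomorphism is a simple root of some
polynomial, in characteristic zero. -/
theorem exists_eval₂_eq_zero_derivative_ne_zero {A B : Type*} [CommRing A] [IsDomain A]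
    [CharZero A] [CommRing B] {φ : A →+* B} (hφ : Function.Injective φ) {b : B}
    (hb : φ.IsIntegralElem b) :
    ∃ P : Polynomial A, P.eval₂ φ b = 0 ∧ P.derivative.eval₂ φ b ≠ 0 := by
  -- Descent on the degree: if `P.derivative` also kills `b`, it replaces `P`. It is nonzero in
  -- characteristic zero unless `P` is constant, and a nonzero constant cannot vanish at `b` since
  -- `φ` is injective.
  have key : ∀ n (P : Polynomial A), P.natDegree = n → P ≠ 0 → P.eval₂ φ b = 0 →
      ∃ P : Polynomial A, P.eval₂ φ b = 0 ∧ P.derivative.eval₂ φ b ≠ 0 := by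
    intro n
    induction n using Nat.strong_induction_on with
    | _ n ih =>
      intro P hn hP h0
      by_cases hd : P.derivative.eval₂ φ b = 0
      · by_cases hd0 : P.natDegree = 0
        · rw [Polynomial.natDegree_eq_zero] at hd0
          obtain ⟨c, rfl⟩ := hd0
          rw [Polynomial.eval₂_C] at h0
          exact absurd (by rw [(map_eq_zero_iff φ hφ).1 h0, Polynomial.C_0]) hP
        · exact ih _ (hn ▸ Polynomial.natDegree_derivative_lt hd0) _ rfl
            (fun h => hd0 (Polynomial.derivative_eq_zero.1 h)) hd
      · exact ⟨P, h0, hd⟩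
  obtain ⟨P, hP, h0⟩ := hb
  exact key _ P rfl hP.ne_zero h0

theorem derivation_eval₂ {K A B : Type*} [CommRing K] [CommRing A] [CommRing B] [Algebra K B]
    (D : Derivation K B B) (ρ : A →+* B) (hρ : ∀ p, D (ρ p) = 0) (u : B) (P : Polynomial A) :
    D (P.eval₂ ρ u) = P.derivative.eval₂ ρ u * D u := by
  induction P using Polynomial.induction_on' with
  | add p q hp hq => simp [Polynomial.eval₂_add, hp, hq, add_mul]
  | monomial n c =>
    simp [Polynomial.eval₂_monomial, Polynomial.derivative_monomial, hρ, Derivation.leibniz_pow]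
    ring

theorem pderiv_rename_eq_zero {ι κ : Type*} [Finite κ] (φ : κ → ι) {l : ι}
    (hl : l ∉ Set.range φ) (p : MvPowerSeries κ k) :
    MvPowerSeries.pderiv k l (MvPowerSeries.rename φ p) = 0 := by
  classical
  ext n
  rw [MvPowerSeries.coeff_pderiv, MvPowerSeries.coeff_rename_eq_zero, zero_mul, map_zero]
  rintro ⟨d, hd⟩
  have h := DFunLike.congr_fun hd l
  rw [Finsupp.mapDomain_of_notMem_range _ _ hl] at h
  simp at h

/-- Over `k⟦y i₀⟧`, each `y j` is a simple root of a polynomial. -/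
theorem exists_relation [CharZero k] {ι : Type*} [Finite ι] (y : ι → k⟦X⟧)
    (hy : ∀ i, PowerSeries.constantCoeff (y i) = 0) {i₀ : ι} (h0 : y i₀ ≠ 0) {j : ι}
    (hj : j ≠ i₀) :
    ∃ g, evalHom y hy g = 0 ∧ evalHom y hy (MvPowerSeries.pderiv k j g) ≠ 0 ∧
      ∀ l, l ≠ i₀ → l ≠ j → MvPowerSeries.pderiv k l g = 0 := by
  have : CharZero k⟦X⟧ := charZero_of_injective_algebraMap (algebraMap k k⟦X⟧).injective
  obtain ⟨P, hP0, hP1⟩ := exists_eval₂_eq_zero_derivative_ne_zero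
    (φ := (evalOne (y i₀) (hy i₀)).toRingHom)
    (evalOne_injective (hy i₀) h0) (evalOne_isIntegral (hy i₀) h0 (y j))
  -- The coefficients of `P` are lifted to series in the variable `i₀` alone, so that only the
  -- variables `i₀` and `j` occur in the relation.
  let ρ : k⟦X⟧ →ₐ[k] MvPowerSeries ι k := MvPowerSeries.rename (fun _ : Unit => i₀)
  have hcomp : (evalHom y hy).toRingHom.comp ρ.toRingHom = (evalOne (y i₀) (hy i₀)).toRingHom :=
    RingHom.ext fun p => evalHom_rename y hy (fun _ : Unit => i₀) p
  have hev : ∀ Q : Polynomial k⟦X⟧, evalHom y hy (Q.eval₂ ρ.toRingHom (MvPowerSeries.X j)) =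
      Q.eval₂ (evalOne (y i₀) (hy i₀)).toRingHom (y j) := fun Q => by
    rw [← hcomp, ← evalHom_X y hy j]
    exact Polynomial.hom_eval₂ Q ρ.toRingHom (evalHom y hy).toRingHom (MvPowerSeries.X j)
  have hd : ∀ l, l ≠ i₀ →
      MvPowerSeries.pderiv k l (P.eval₂ ρ.toRingHom (MvPowerSeries.X j)) =
      P.derivative.eval₂ ρ.toRingHom (MvPowerSeries.X j) *
        MvPowerSeries.pderiv k l (MvPowerSeries.X j) := fun l hl =>
    derivation_eval₂ _ _ (fun p => pderiv_rename_eq_zero _ (by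
      rintro ⟨_, rfl⟩
      exact hl rfl) p) _ _
  refine ⟨P.eval₂ ρ.toRingHom (MvPowerSeries.X j), by rw [hev, hP0], ?_, fun l hl hlj => ?_⟩
  · rw [hd j hj, MvPowerSeries.pderiv_X_self, mul_one, hev]
    exact hP1
  · rw [hd l hl, MvPowerSeries.pderiv_X_of_ne hlj.symm, mul_zero]

/-! ### A lower bound for the length -/

section Length

/-- A module has length at least `N` if it contains `N` elements all of whose relations have
coefficients in a fixed proper ideal. -/
theorem card_le_length {A M ι : Type*} [CommRing A] [AddCommGroup M] [Module A M] [Fintype ι]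
    {I : Ideal A} (hI : I ≠ ⊤) (ω : ι → M) (h : ∀ s : ι → A, ∑ i, s i • ω i = 0 → ∀ i, s i ∈ I) :
    (Fintype.card ι : ℕ∞) ≤ Module.length A M := by
  classical
  let F : (ι → A) →ₗ[A] M := Fintype.linearCombination A ω
  let q : (ι → A) →ₗ[A] (ι → A ⧸ I) := LinearMap.pi fun i => I.mkQ ∘ₗ LinearMap.proj i
  have hq : Function.Surjective q := fun v => by
    choose w hw using fun i => Ideal.Quotient.mk_surjective (v i)
    exact ⟨w, funext hw⟩
  have hFq : LinearMap.ker F ≤ LinearMap.ker q := fun s hs => by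
    rw [LinearMap.mem_ker, Fintype.linearCombination_apply] at hs
    rw [LinearMap.mem_ker]
    funext i
    exact Ideal.Quotient.eq_zero_iff_mem.2 (h s hs i)
  -- The submodule spanned by the `ω i` surjects onto `(A ⧸ I) ^ ι`, and each nonzero factor has
  -- length at least one.
  have h1 : Module.length A (ι → A ⧸ I) ≤ Module.length A ((ι → A) ⧸ LinearMap.ker F) :=
    Module.length_le_of_surjective ((LinearMap.ker F).liftQ q hFq) fun v => by
      obtain ⟨w, rfl⟩ := hq v
      exact ⟨Submodule.Quotient.mk w, rfl⟩
  have h2 : Module.length A ((ι → A) ⧸ LinearMap.ker F) ≤ Module.length A M :=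
    Module.length_le_of_injective ((LinearMap.ker F).liftQ F le_rfl)
      (LinearMap.ker_eq_bot.1 (Submodule.ker_liftQ_eq_bot _ _ _ le_rfl))
  refine le_trans ?_ (h1.trans h2)
  have : Nontrivial (A ⧸ I) := Ideal.Quotient.nontrivial_iff.2 hI
  rw [Module.length_pi_of_fintype]
  calc (Fintype.card ι : ℕ∞) = ∑ _i : ι, (1 : ℕ∞) := by simp
    _ ≤ _ := Finset.sum_le_sum fun i _ => Order.one_le_iff_pos.2 Module.length_pos

end Length

/-! ### Relations in `Ω_S` and symmetry of Hessians -/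

section Jacobian

variable {ι S : Type*} [CommRing S] [Algebra k S] {Φ : MvPowerSeries ι k →ₐ[k] S}

/-- The span is superfluous: for `g` in the kernel, the Leibniz rule makes the gradient of `p * g`
equal to `p` times that of `g` after applying `Φ`. -/
theorem mem_jacobianSubmodule (hΦ : Function.Surjective Φ) {v : ι → S} :
    v ∈ jacobianSubmodule Φ ↔ ∃ g, Φ g = 0 ∧ v = fun i => Φ (MvPowerSeries.pderiv k i g) := by
  refine ⟨fun hv => ?_, fun h => Submodule.subset_span h⟩
  induction hv using Submodule.span_induction with
  | mem v h => exact h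
  | zero => exact ⟨0, map_zero _, by simp [Pi.zero_def]⟩
  | add v w _ _ hv hw =>
    obtain ⟨g, hg, rfl⟩ := hv
    obtain ⟨h, hh, rfl⟩ := hw
    exact ⟨g + h, by rw [map_add, hg, hh, add_zero], by funext i; simp⟩
  | smul r v _ hv =>
    obtain ⟨g, hg, rfl⟩ := hv
    obtain ⟨p, rfl⟩ := hΦ r
    exact ⟨p * g, by rw [map_mul, hg, mul_zero], by
      funext i; simp [hg, Derivation.leibniz]⟩

theorem Omega.mk_eq_zero {v : ι → S} : Omega.mk Φ v = 0 ↔ v ∈ jacobianSubmodule Φ :=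
  Submodule.Quotient.mk_eq_zero _

theorem constantCoeff_pderiv (u : ι) (g : MvPowerSeries ι k) :
    MvPowerSeries.constantCoeff (MvPowerSeries.pderiv k u g) =
      MvPowerSeries.coeff (Finsupp.single u 1) g := by
  rw [← MvPowerSeries.coeff_zero_eq_constantCoeff_apply, MvPowerSeries.coeff_pderiv]
  simp

theorem constantCoeff_pderiv_pderiv_comm (u w : ι) (g : MvPowerSeries ι k) :
    MvPowerSeries.constantCoeff (MvPowerSeries.pderiv k u (MvPowerSeries.pderiv k w g)) =
      MvPowerSeries.constantCoeff (MvPowerSeries.pderiv k w (MvPowerSeries.pderiv k u g)) := by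
  classical
  rw [constantCoeff_pderiv, constantCoeff_pderiv, MvPowerSeries.coeff_pderiv,
    MvPowerSeries.coeff_pderiv, add_comm (Finsupp.single u 1)]
  simp only [Finsupp.single_apply, eq_comm]

/-- The difference of two opposite entries of the matrix of linear parts of a vector. -/
def antisymm {ι : Type*} (V : ι → MvPowerSeries ι k) (u w : ι) : k :=
  MvPowerSeries.constantCoeff (MvPowerSeries.pderiv k w (V u)) -
    MvPowerSeries.constantCoeff (MvPowerSeries.pderiv k u (V w))

/-- A relation in `Ω_S` between classes of vectors with entries in the maximal ideal makes the
matrix of linear parts symmetric, because Hessians are. -/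
theorem sum_antisymm_eq_zero {P : Type*} [Fintype P] (hΦ : Function.Surjective Φ)
    (hker : ∀ g, Φ g = 0 → MvPowerSeries.constantCoeff g = 0 ∧
      ∀ u, MvPowerSeries.constantCoeff (MvPowerSeries.pderiv k u g) = 0)
    (V : P → ι → MvPowerSeries ι k) (hV : ∀ p w, MvPowerSeries.constantCoeff (V p w) = 0)
    (σ : P → MvPowerSeries ι k)
    (h : ∑ p, Φ (σ p) • Omega.mk Φ (fun w => Φ (V p w)) = 0) (u w : ι) :
    ∑ p, MvPowerSeries.constantCoeff (σ p) * antisymm (V p) u w = 0 := by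
  have h1 : Omega.mk Φ (∑ p, Φ (σ p) • fun w => Φ (V p w)) = 0 := by
    rw [← h]
    simp [Omega.mk]
  rw [Omega.mk_eq_zero, mem_jacobianSubmodule hΦ] at h1
  obtain ⟨g, -, hv⟩ := h1
  have h2 : ∀ u w, ∑ p, MvPowerSeries.constantCoeff (σ p) *
      MvPowerSeries.constantCoeff (MvPowerSeries.pderiv k w (V p u)) =
      MvPowerSeries.constantCoeff (MvPowerSeries.pderiv k w (MvPowerSeries.pderiv k u g)) := by
    intro u w
    -- The combination equals the gradient only modulo `ker Φ`, whose elements have no linear part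
    -- by `hker`; hence the linear parts agree exactly.
    have h3 : Φ (∑ p, σ p * V p u - MvPowerSeries.pderiv k u g) = 0 := by
      have := congrFun hv u
      simp only [Finset.sum_apply, Pi.smul_apply, smul_eq_mul] at this
      simp [this]
    have h4 := (hker _ h3).2 w
    rw [map_sub, map_sub, sub_eq_zero] at h4
    rw [← h4]
    simp [Derivation.leibniz, hV]
  simp only [antisymm, mul_sub, Finset.sum_sub_distrib, h2]
  rw [constantCoeff_pderiv_pderiv_comm, sub_self]

end Jacobian

/-! ### Forms vanishing in `k⟦t⟧ dt` are torsion -/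

section Torsion

variable [CharZero k] {ι : Type*} [Fintype ι] (y : ι → k⟦X⟧)
  (hy : ∀ i, PowerSeries.constantCoeff (y i) = 0) {S : Subalgebra k k⟦X⟧}
  {Φ : MvPowerSeries ι k →ₐ[k] S}

theorem derivative_ne_zero {f : k⟦X⟧} (hf : PowerSeries.constantCoeff f = 0) (h0 : f ≠ 0) :
    PowerSeries.derivative k f ≠ 0 := fun h =>
  h0 (PowerSeries.derivative.ext (by rw [h, map_zero]) (by rw [hf, map_zero]))

/-- A differential form with zero image in `k⟦t⟧ dt` is torsion. -/
theorem mk_mem_torsion (hΦ : Function.Surjective Φ)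
    (hΦy : ∀ g, (Φ g : k⟦X⟧) = evalHom y hy g) {i₀ : ι} (h0 : y i₀ ≠ 0) (v : ι → S)
    (hv : ∑ i, (v i : k⟦X⟧) * PowerSeries.derivative k (y i) = 0) :
    Omega.mk Φ v ∈ Submodule.torsion S (Omega Φ) := by
  classical
  have hΦ0 : ∀ g, Φ g = 0 ↔ evalHom y hy g = 0 := fun g => by
    rw [← hΦy, ZeroMemClass.coe_eq_zero]
  -- Rank one: a nonzero multiple of each basis differential is a multiple of the one with index
  -- `i₀`.
  have hsingle : ∀ j, ∃ s r : S, s ≠ 0 ∧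
      s • Pi.single j 1 - r • Pi.single i₀ 1 ∈ jacobianSubmodule Φ := by
    intro j
    by_cases hj : j = i₀
    · subst hj
      exact ⟨1, 1, one_ne_zero, by simp⟩
    · obtain ⟨g, hg, hg1, hg2⟩ := exists_relation y hy h0 hj
      refine ⟨Φ (MvPowerSeries.pderiv k j g), -Φ (MvPowerSeries.pderiv k i₀ g),
        (hΦ0 _).not.2 hg1, (mem_jacobianSubmodule hΦ).2 ⟨g, (hΦ0 _).2 hg, ?_⟩⟩
      funext l
      by_cases hl : l = i₀
      · subst hl
        simp [Ne.symm hj]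
      · by_cases hlj : l = j
        · subst hlj
          simp [hl]
        · simp [hl, hlj, hg2 l hl hlj]
  have hred : ∃ s r : S, s ≠ 0 ∧
      s • v - r • Pi.single i₀ 1 ∈ jacobianSubmodule Φ := by
    have hsum : v = ∑ j, v j • Pi.single j 1 := by
      funext l
      simp [Finset.sum_apply, Pi.single_apply]
    rw [hsum]
    refine Finset.sum_induction _ (fun w => ∃ s r : S, s ≠ 0 ∧
      s • w - r • Pi.single i₀ 1 ∈ jacobianSubmodule Φ) ?_ ?_ ?_
    · rintro w w' ⟨s, r, hs, h⟩ ⟨s', r', hs', h'⟩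
      refine ⟨s * s', s' * r + s * r', mul_ne_zero hs hs', ?_⟩
      convert add_mem (Submodule.smul_mem _ s' h) (Submodule.smul_mem _ s h') using 1
      funext l
      simp only [Pi.sub_apply, Pi.add_apply, Pi.smul_apply, smul_eq_mul]
      ring
    · exact ⟨1, 0, one_ne_zero, by simp⟩
    · intro j _
      obtain ⟨s, r, hs, h⟩ := hsingle j
      refine ⟨s, v j * r, hs, ?_⟩
      convert Submodule.smul_mem _ (v j) h using 1
      funext l
      simp only [Pi.sub_apply, Pi.smul_apply, smul_eq_mul]
      ring
  obtain ⟨s, r, hs, h⟩ := hred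
  -- Both the relation and `v` map to zero in `k⟦t⟧ dt`, so `r` times the nonzero derivative of `y
  -- i₀` vanishes.
  have hr : r = 0 := by
    obtain ⟨g, hg, hg'⟩ := (mem_jacobianSubmodule hΦ).1 h
    have h1 := derivative_evalHom y hy g
    rw [(hΦ0 g).1 hg, map_zero] at h1
    have h2 : ∀ i, evalHom y hy (MvPowerSeries.pderiv k i g) =
        (s : k⟦X⟧) * v i - r * (Pi.single i₀ 1 : ι → k⟦X⟧) i := fun i => by
      rw [← hΦy, ← congrFun hg' i]
      by_cases hi : i = i₀
      · subst hi; simp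
      · simp [hi]
    simp only [h2, sub_mul, Finset.sum_sub_distrib, mul_assoc, ← Finset.mul_sum, hv] at h1
    have h3 : (r : k⟦X⟧) * PowerSeries.derivative k (y i₀) = 0 := by
      simpa [Pi.single_apply] using h1
    exact Subtype.ext ((mul_eq_zero.1 h3).resolve_right (derivative_ne_zero (hy i₀) h0))
  rw [hr, zero_smul, sub_zero] at h
  refine (Submodule.mem_torsion_iff _).2 ⟨⟨s, mem_nonZeroDivisors_of_ne_zero hs⟩, ?_⟩
  change s • Omega.mk Φ v = 0
  rw [← Omega.mk_eq_zero.2 h]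
  simp [Omega.mk]

end Torsion

/-! ### Fractional powers through logarithmic derivatives -/

section Ode

/-- Coefficients of the solution of `u' = g u`, `u(0) = 1`. -/
def odeCoeff (g : k⟦X⟧) : ℕ → k
  | 0 => 1
  | m + 1 => (∑ i : Fin (m + 1), odeCoeff g i * PowerSeries.coeff (m - i) g) / (m + 1)

theorem exists_derivative_eq_mul [CharZero k] (g : k⟦X⟧) :
    ∃ u : k⟦X⟧, PowerSeries.constantCoeff u = 1 ∧ PowerSeries.derivative k u = g * u := by
  refine ⟨PowerSeries.mk (odeCoeff g), ?_, ?_⟩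
  · rw [← PowerSeries.coeff_zero_eq_constantCoeff_apply, PowerSeries.coeff_mk, odeCoeff]
  · ext m
    rw [PowerSeries.coeff_derivative, PowerSeries.coeff_mk, odeCoeff,
      div_mul_cancel₀ _ (by exact_mod_cast Nat.succ_ne_zero m), mul_comm g, PowerSeries.coeff_mul,
      Finset.Nat.sum_antidiagonal_eq_sum_range_succ_mk,
      Fin.sum_univ_eq_sum_range (fun i => odeCoeff g i * PowerSeries.coeff (m - i) g)]
    simp

/-- The power `x ^ (b / a)`, normalised to have leading term `X ^ b`, when `x` has order `a`. -/
theorem exists_logDerivative_eq [CharZero k] (α : k⟦X⟧ˣ) {a : ℕ} (ha : a ≠ 0) (b : ℕ) :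
    ∃ w : k⟦X⟧, PowerSeries.X ^ (b + 1) ∣ w - PowerSeries.X ^ b ∧
      (b : k⟦X⟧) * w * PowerSeries.derivative k ((α : k⟦X⟧) * PowerSeries.X ^ a) =
        (a : k⟦X⟧) * ((α : k⟦X⟧) * PowerSeries.X ^ a) * PowerSeries.derivative k w := by
  -- Here `u` plays the role of `α ^ (b / a)` with constant term one: its logarithmic derivative is
  -- `b / a` times that of `α`.
  obtain ⟨u, hu0, hu⟩ := exists_derivative_eq_mul
    (((b : k) / a) • ((↑α⁻¹ : k⟦X⟧) * PowerSeries.derivative k (α : k⟦X⟧)))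
  have ha' : (a : k) ≠ 0 := Nat.cast_ne_zero.2 ha
  have hu' : (a : k⟦X⟧) * α * PowerSeries.derivative k u =
      (b : k⟦X⟧) * PowerSeries.derivative k (α : k⟦X⟧) * u := by
    have h1 : (a : k⟦X⟧) * PowerSeries.C ((b : k) / a) = b := by
      rw [← map_natCast (PowerSeries.C (R := k)) a, ← map_mul, mul_div_cancel₀ _ ha', map_natCast]
    rw [hu, PowerSeries.smul_eq_C_mul]
    linear_combination (α * ↑α⁻¹ * PowerSeries.derivative k (α : k⟦X⟧) * u) * h1 +
      (b : k⟦X⟧) * PowerSeries.derivative k (α : k⟦X⟧) * u * α.mul_inv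
  refine ⟨PowerSeries.X ^ b * u, ?_, ?_⟩
  · rw [pow_succ, ← mul_sub_one]
    exact mul_dvd_mul_left _ (PowerSeries.X_dvd_iff.2 (by simp [hu0]))
  · have hX : ∀ m : ℕ, PowerSeries.X * PowerSeries.derivative k (PowerSeries.X ^ m) =
        (m : k⟦X⟧) * PowerSeries.X ^ m := fun m => by
      cases m with
      | zero => simp
      | succ m =>
        rw [PowerSeries.derivative_pow, PowerSeries.derivative_X, Nat.add_sub_cancel]
        ring
    refine mul_left_cancel₀ (PowerSeries.X_ne_zero (R := k)) ?_
    simp only [Derivation.leibniz, smul_eq_mul]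
    linear_combination (-PowerSeries.X ^ a * PowerSeries.X ^ b * PowerSeries.X) * hu' +
      ((b : k⟦X⟧) * PowerSeries.X ^ b * u * α) * hX a -
      ((a : k⟦X⟧) * (α * PowerSeries.X ^ a) * u) * hX b

end Ode

/-! ### Antisymmetric parts of the torsion elements -/

section Elements

variable {n s : ℕ}

/-- The coefficients of `[x_i, T_j]`, as power series. -/
def bracketVec (a : Fin n → ℕ) (b : Fin s → ℕ) (i : Fin n) (j : Fin s)
    (f : MvPowerSeries (Fin n) k) (δ : Fin s → k) : Fin n ⊕ Fin s → MvPowerSeries (Fin n ⊕ Fin s) k :=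
  Sum.elim
    (fun u => (if u = i then MvPowerSeries.C (b j : k) * (MvPowerSeries.X (Sum.inr j) +
        MvPowerSeries.rename Sum.inl f +
        ∑ l, MvPowerSeries.C (δ l) * MvPowerSeries.X (Sum.inr l)) else 0)
      - MvPowerSeries.C (a i : k) * (MvPowerSeries.X (Sum.inl i) *
        MvPowerSeries.rename Sum.inl (MvPowerSeries.pderiv k u f)))
    (fun l => - (MvPowerSeries.C ((a i : k) * ((if l = j then 1 else 0) + δ l)) *
      MvPowerSeries.X (Sum.inl i)))

/-- The coefficients of `Γ_{ij}`, as power series. -/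
def gamVec (b : Fin s → ℕ) (i j : Fin s) : Fin n ⊕ Fin s → MvPowerSeries (Fin n ⊕ Fin s) k :=
  Sum.elim (fun _ => 0)
    (fun l => MvPowerSeries.C (if l = i then (b j : k) else 0) * MvPowerSeries.X (Sum.inr j) -
      MvPowerSeries.C (if l = j then (b i : k) else 0) * MvPowerSeries.X (Sum.inr i))

variable {S : Type*} [CommRing S] [Algebra k S] (Φ : MvPowerSeries (Fin n ⊕ Fin s) k →ₐ[k] S)

theorem map_C_eq_algebraMap {ι : Type*} (Φ : MvPowerSeries ι k →ₐ[k] S) (r : k) :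
    Φ (MvPowerSeries.C r) = algebraMap k S r := Φ.commutes r

theorem bracket_eq_mk (a : Fin n → ℕ) (b : Fin s → ℕ) (i : Fin n) (j : Fin s)
    (f : MvPowerSeries (Fin n) k) (δ : Fin s → k) :
    bracket Φ a b i j f δ = Omega.mk Φ (fun w => Φ (bracketVec a b i j f δ w)) := by
  refine congrArg (Omega.mk Φ) (funext fun w => ?_)
  rcases w with u | l
  · by_cases hu : u = i
    · simp [bracketVec, hu, map_C_eq_algebraMap, Algebra.smul_def, mul_assoc]
    · simp [bracketVec, hu, mul_assoc]
  · by_cases hl : l = j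
    · simp [bracketVec, hl, map_C_eq_algebraMap]
      ring
    · simp [bracketVec, hl, map_C_eq_algebraMap]
      ring

theorem Gam_eq_mk (b : Fin s → ℕ) (i j : Fin s) :
    Gam Φ b i j = Omega.mk Φ (fun w => Φ (gamVec b i j w)) := by
  have h : Gam Φ b i j = Omega.mk Φ
      (((b j : S) * Φ (MvPowerSeries.X (Sum.inr j))) • Pi.single (Sum.inr i) 1 -
        ((b i : S) * Φ (MvPowerSeries.X (Sum.inr i))) • Pi.single (Sum.inr j) 1) := by
    simp [Gam, Omega.d, Omega.mk]
  rw [h]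
  congr 1
  funext w
  rcases w with u | l
  · simp [gamVec]
  · simp only [gamVec, Sum.elim_inr, map_sub, map_mul, map_C_eq_algebraMap, Pi.sub_apply,
      Pi.smul_apply, Pi.single_apply, Sum.inr.injEq, smul_eq_mul]
    split_ifs <;> simp

theorem constantCoeff_bracketVec (a : Fin n → ℕ) (b : Fin s → ℕ) (i : Fin n) (j : Fin s)
    {f : MvPowerSeries (Fin n) k} (hf : MvPowerSeries.constantCoeff f = 0) (δ : Fin s → k)
    (w : Fin n ⊕ Fin s) : MvPowerSeries.constantCoeff (bracketVec a b i j f δ w) = 0 := by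
  rcases w with u | l
  · by_cases hu : u = i <;> simp [bracketVec, hu, hf]
  · simp [bracketVec]

theorem constantCoeff_gamVec (b : Fin s → ℕ) (i j : Fin s) (w : Fin n ⊕ Fin s) :
    MvPowerSeries.constantCoeff (gamVec b i j w : MvPowerSeries (Fin n ⊕ Fin s) k) = 0 := by
  rcases w with u | l
  · simp [gamVec]
  · simp [gamVec]

theorem constantCoeff_pderiv_X {ι : Type*} [DecidableEq ι] (u w : ι) :
    MvPowerSeries.constantCoeff (MvPowerSeries.pderiv k u (MvPowerSeries.X w)) =
      if u = w then 1 else 0 := by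
  by_cases h : u = w
  · subst h; simp [MvPowerSeries.pderiv_X_self]
  · simp [MvPowerSeries.pderiv_X_of_ne (Ne.symm h), h]

theorem pderiv_inr_rename_inl (l : Fin s) (f : MvPowerSeries (Fin n) k) :
    MvPowerSeries.pderiv k (Sum.inr l)
      (MvPowerSeries.rename Sum.inl f : MvPowerSeries (Fin n ⊕ Fin s) k) = 0 :=
  pderiv_rename_eq_zero _ (by simp) f

/-- The coefficient of `dx_i` contributes `b_j`, and that of `dT_l` contributes `-a_i`, which the
difference turns into a sum. The series `f` does not involve `T`, so it affects only the block of
the `x` variables, which is never used. -/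
theorem antisymm_bracketVec_inl_inr (a : Fin n → ℕ) (b : Fin s → ℕ) (i : Fin n) (j : Fin s)
    (f : MvPowerSeries (Fin n) k) (δ : Fin s → k) (u : Fin n) (l : Fin s) :
    antisymm (bracketVec a b i j f δ) (Sum.inl u) (Sum.inr l) =
      if u = i then ((a i : k) + b j) * ((if l = j then 1 else 0) + δ l) else 0 := by
  by_cases hu : u = i
  · subst hu
    simp only [antisymm, bracketVec, Sum.elim_inl, Sum.elim_inr, if_true, map_sub, map_neg,
      map_add, map_sum, map_mul, Derivation.leibniz, smul_eq_mul, constantCoeff_pderiv_X,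
      pderiv_inr_rename_inl, MvPowerSeries.constantCoeff_C, MvPowerSeries.pderiv_C,
      map_zero, mul_zero, add_zero, Sum.inr.injEq,
      reduceCtorEq, if_false, mul_ite, mul_one, Finset.sum_ite_eq, Finset.mem_univ]
    ring
  · simp [antisymm, bracketVec, Derivation.leibniz, constantCoeff_pderiv_X,
      pderiv_inr_rename_inl, hu]

theorem antisymm_bracketVec_inr_inr (a : Fin n → ℕ) (b : Fin s → ℕ) (i : Fin n) (j : Fin s)
    (f : MvPowerSeries (Fin n) k) (δ : Fin s → k) (l m : Fin s) :
    antisymm (bracketVec a b i j f δ) (Sum.inr l) (Sum.inr m) = 0 := by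
  simp [antisymm, bracketVec, Derivation.leibniz]

theorem antisymm_gamVec_inl_inr (b : Fin s → ℕ) (i j : Fin s) (u : Fin n) (l : Fin s) :
    antisymm (gamVec b i j : _ → MvPowerSeries (Fin n ⊕ Fin s) k) (Sum.inl u) (Sum.inr l) = 0 := by
  simp [antisymm, gamVec, Derivation.leibniz]

theorem antisymm_gamVec_inr_inr (b : Fin s → ℕ) {i j l m : Fin s} (hij : i < j) (hlm : l < m) :
    antisymm (gamVec b i j : _ → MvPowerSeries (Fin n ⊕ Fin s) k) (Sum.inr l) (Sum.inr m) =
      if l = i ∧ m = j then (b i : k) + b j else 0 := by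
  simp only [antisymm, gamVec, Sum.elim_inr, map_sub, Derivation.leibniz,
    smul_eq_mul, map_mul, constantCoeff_pderiv_X, MvPowerSeries.constantCoeff_C,
    MvPowerSeries.pderiv_C, Sum.inr.injEq, mul_zero, add_zero, mul_ite, mul_one]
  split_ifs <;> first | omega | (simp; done) | (simp; ring)

/-- The entries at `(x_i, T_l)` see only the brackets with first index `i`, and the entry at `(T_l,
T_m)` sees only `Γ_{lm}`. The resulting linear system is triangular, with sums of exponents on the
diagonal, nonzero in characteristic zero. -/
theorem constantCoeff_eq_zero_of_relation [CharZero k] (hΦ : Function.Surjective Φ)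
    (hker : ∀ g, Φ g = 0 → MvPowerSeries.constantCoeff g = 0 ∧
      ∀ u, MvPowerSeries.constantCoeff (MvPowerSeries.pderiv k u g) = 0)
    {a : Fin n → ℕ} {b : Fin s → ℕ} (hb : ∀ j, b j ≠ 0)
    {f : Fin n → Fin s → MvPowerSeries (Fin n) k}
    (hf : ∀ i j, MvPowerSeries.constantCoeff (f i j) = 0) {δ : Fin n → Fin s → Fin s → k}
    (hδ : ∀ i j l, l ≤ j → δ i j l = 0)
    (σ : (Fin n × Fin s) ⊕ {p : Fin s × Fin s // p.1 < p.2} → MvPowerSeries (Fin n ⊕ Fin s) k)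
    (h : ∑ p, Φ (σ p) • Sum.elim
      (fun p : Fin n × Fin s => bracket Φ a b p.1 p.2 (f p.1 p.2) (δ p.1 p.2))
      (fun p : {p : Fin s × Fin s // p.1 < p.2} => Gam Φ b p.1.1 p.1.2) p = 0) (p) :
    MvPowerSeries.constantCoeff (σ p) = 0 := by
  have key := sum_antisymm_eq_zero hΦ hker (Sum.elim
      (fun p : Fin n × Fin s => bracketVec a b p.1 p.2 (f p.1 p.2) (δ p.1 p.2))
      (fun p : {p : Fin s × Fin s // p.1 < p.2} => gamVec b p.1.1 p.1.2))
    (by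
      rintro (p | p) w
      · exact constantCoeff_bracketVec _ _ _ _ (hf _ _) _ _
      · exact constantCoeff_gamVec _ _ _ _) σ (by
      rw [← h]
      refine Finset.sum_congr rfl fun p _ => ?_
      rcases p with p | p
      · simp only [Sum.elim_inl, bracket_eq_mk]
      · simp only [Sum.elim_inr, Gam_eq_mk])
  rcases p with ⟨i, l⟩ | ⟨⟨l, m⟩, hlm⟩
  -- In the equation at `(x_i, T_l)`, the terms with `j < l` vanish by induction and those with `j >
  -- l` because `δ i j l = 0`.
  · induction l using WellFoundedLT.induction with
    | _ l ih =>
      have h1 := key (Sum.inl i) (Sum.inr l)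
      simp only [Fintype.sum_sum_type, Sum.elim_inl, Sum.elim_inr,
        antisymm_gamVec_inl_inr, antisymm_bracketVec_inl_inr, mul_zero, Finset.sum_const_zero,
        add_zero, Fintype.sum_prod_type] at h1
      rw [Finset.sum_eq_single i (fun u _ hu => by simp [hu.symm]) (by simp),
        Finset.sum_eq_single l (fun j _ hj => by
          rcases lt_or_gt_of_ne hj with hj | hj
          · rw [ih j hj, zero_mul]
          · simp [hj.ne, hδ i j l hj.le]) (by simp)] at h1
      simp only [if_true, hδ i l l le_rfl, add_zero, mul_one] at h1
      refine (mul_eq_zero.1 h1).resolve_right ?_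
      exact_mod_cast fun h => hb l (by omega)
  · have h1 := key (Sum.inr l) (Sum.inr m)
    simp only [Fintype.sum_sum_type, Sum.elim_inl, Sum.elim_inr,
      antisymm_bracketVec_inr_inr, mul_zero, Finset.sum_const_zero, zero_add] at h1
    rw [Finset.sum_eq_single (⟨(l, m), hlm⟩ : {p : Fin s × Fin s // p.1 < p.2}) (fun p _ hp => by
        rw [antisymm_gamVec_inr_inr b p.2 hlm, if_neg, mul_zero]
        rintro ⟨rfl, rfl⟩
        exact hp rfl) (by simp),
      antisymm_gamVec_inr_inr b hlm hlm, if_pos ⟨rfl, rfl⟩] at h1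
    refine (mul_eq_zero.1 h1).resolve_right fun h => hb l ?_
    have h2 : b l + b m = 0 := by exact_mod_cast h
    omega

end Elements

/-! ### The brackets and the `Γ_ij` are torsion -/

section TorsionElements

variable [CharZero k] {n s : ℕ} {x : Fin n → k⟦X⟧} {T : Fin s → k⟦X⟧}
  {hx0 : ∀ i, PowerSeries.constantCoeff (x i) = 0}
  {hy : ∀ i, PowerSeries.constantCoeff ((Sum.elim x T : _ → k⟦X⟧) i) = 0} {S : Subalgebra k k⟦X⟧}
  {Φ : MvPowerSeries (Fin n ⊕ Fin s) k →ₐ[k] S}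

theorem bracket_mem_torsion (hΦ : Function.Surjective Φ)
    (hΦy : ∀ g, (Φ g : k⟦X⟧) = evalHom (Sum.elim x T) hy g) {i₀ : Fin n} (h0 : x i₀ ≠ 0)
    (a : Fin n → ℕ) (b : Fin s → ℕ) (i : Fin n) (j : Fin s)
    (f : MvPowerSeries (Fin n) k) (δ : Fin s → k) {w : k⟦X⟧}
    (hw : w = T j + evalHom x hx0 f + ∑ l, δ l • T l)
    (hwd : (b j : k⟦X⟧) * w * PowerSeries.derivative k (x i) =
      (a i : k⟦X⟧) * x i * PowerSeries.derivative k w) :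
    bracket Φ a b i j f δ ∈ Submodule.torsion S (Omega Φ) := by
  rw [bracket_eq_mk]
  refine mk_mem_torsion (Sum.elim x T) hy hΦ hΦy (i₀ := Sum.inl i₀) h0 _ ?_
  have hren : ∀ g, evalHom (Sum.elim x T) hy (MvPowerSeries.rename Sum.inl g) =
      evalHom x hx0 g := fun g => evalHom_rename _ hy Sum.inl g
  have hdw : PowerSeries.derivative k w = PowerSeries.derivative k (T j) +
      ∑ u, evalHom x hx0 (MvPowerSeries.pderiv k u f) *
        PowerSeries.derivative k (x u) + ∑ l, δ l • PowerSeries.derivative k (T l) := by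
    rw [hw, map_add, map_add, derivative_evalHom, map_sum]
    simp
  have h1 : ∀ u, (Φ (bracketVec a b i j f δ (Sum.inl u)) : k⟦X⟧) =
      (if u = i then (b j : k⟦X⟧) * w else 0) -
      (a i : k⟦X⟧) * (x i * evalHom x hx0 (MvPowerSeries.pderiv k u f)) :=
    fun u => by
      by_cases hu : u = i <;>
        simp [hΦy, bracketVec, hu, evalHom_C, evalHom_X, hren, hw, PowerSeries.smul_eq_C_mul]
  have h2 : ∀ l, (Φ (bracketVec a b i j f δ (Sum.inr l)) : k⟦X⟧) =
      -((a i : k⟦X⟧) * ((if l = j then 1 else 0) + PowerSeries.C (δ l)) * x i) := fun l => by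
    by_cases hl : l = j <;> simp [hΦy, bracketVec, hl, evalHom_C, evalHom_X]
  simp only [Fintype.sum_sum_type, h1, h2, Sum.elim_inl, Sum.elim_inr, sub_mul, ite_mul, zero_mul,
    Finset.sum_sub_distrib, Finset.sum_ite_eq', Finset.mem_univ, if_true, hwd, hdw, neg_mul,
    Finset.sum_neg_distrib, mul_add, add_mul, Finset.sum_add_distrib, mul_ite, mul_zero,
    mul_one, Finset.mul_sum, PowerSeries.smul_eq_C_mul]
  simp only [← mul_assoc, mul_right_comm _ _ (x i)]
  ring

theorem Gam_mem_torsion (hΦ : Function.Surjective Φ)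
    (hΦy : ∀ g, (Φ g : k⟦X⟧) = evalHom (Sum.elim x T) hy g) {i₀ : Fin n} (h0 : x i₀ ≠ 0)
    (b : Fin s → ℕ) (i j : Fin s)
    (hT : (b j : k⟦X⟧) * T j * PowerSeries.derivative k (T i) =
      (b i : k⟦X⟧) * T i * PowerSeries.derivative k (T j)) :
    Gam Φ b i j ∈ Submodule.torsion S (Omega Φ) := by
  rw [Gam_eq_mk]
  refine mk_mem_torsion (Sum.elim x T) hy hΦ hΦy (i₀ := Sum.inl i₀) h0 _ ?_
  have h1 : ∀ u, (Φ (gamVec b i j (Sum.inl u)) : k⟦X⟧) = 0 := fun u => by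
    simp [gamVec]
  have h2 : ∀ l, (Φ (gamVec b i j (Sum.inr l)) : k⟦X⟧) =
      (if l = i then (b j : k⟦X⟧) * T j else 0) - (if l = j then (b i : k⟦X⟧) * T i else 0) :=
    fun l => by
      rw [hΦy]
      simp only [gamVec, Sum.elim_inr, map_sub, map_mul, evalHom_C, evalHom_X]
      split_ifs <;> simp
  simp only [Fintype.sum_sum_type, h1, h2, Sum.elim_inl, Sum.elim_inr, sub_mul, ite_mul, zero_mul,
    Finset.sum_sub_distrib, Finset.sum_ite_eq', Finset.mem_univ, if_true, hT]
  simp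

end TorsionElements

/-! ### The ring `R` and its conductor -/

theorem dvd_X_pow_order {f : k⟦X⟧} (hf : f ≠ 0) : f ∣ PowerSeries.X ^ f.order.toNat := by
  have hu : IsUnit f.divXPowOrder := by
    rw [PowerSeries.isUnit_iff_constantCoeff, isUnit_iff_ne_zero]
    exact PowerSeries.constantCoeff_divXPowOrder_eq_zero_iff.not.2 hf
  conv_lhs => rw [← PowerSeries.X_pow_order_mul_divXPowOrder (f := f)]
  exact (hu.mul_right_dvd).2 dvd_rfl

section CurveRing

variable {ι : Type*} [Finite ι] {x : ι → k⟦X⟧} {hx0 : ∀ i, PowerSeries.constantCoeff (x i) = 0}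

theorem self_mem_curveRing (i : ι) : x i ∈ curveRing x hx0 :=
  ⟨MvPowerSeries.X i, evalHom_X x hx0 i⟩

theorem evalOne_mem_curveRing (i : ι) (g : k⟦X⟧) : evalOne (x i) (hx0 i) g ∈ curveRing x hx0 :=
  ⟨MvPowerSeries.rename (fun _ : Unit => i) g, evalHom_rename x hx0 _ g⟩

/-- An element with nonzero constant term lifts to a unit of the power series ring, so its inverse
stays in the subring. -/
theorem mem_maximalIdeal_curveRing {r : curveRing x hx0} :
    r ∈ IsLocalRing.maximalIdeal (curveRing x hx0) ↔
      PowerSeries.constantCoeff (r : k⟦X⟧) = 0 := by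
  rw [IsLocalRing.mem_maximalIdeal, mem_nonunits_iff, not_iff_comm]
  constructor
  · intro h
    obtain ⟨f, g, rfl⟩ := r
    have hg : IsUnit g := by
      rw [MvPowerSeries.isUnit_iff_constantCoeff, isUnit_iff_ne_zero]
      rw [← constantCoeff_evalHom x hx0]
      exact h
    exact hg.map (evalHom x hx0).rangeRestrict
  · intro h h0
    have h1 := (h.map (curveRing x hx0).val).map (PowerSeries.constantCoeff (R := k))
    rw [Subalgebra.coe_val, h0] at h1
    exact not_isUnit_zero h1

theorem evalHom_mem_orderGE {a : ℕ} (ha : ∀ i, PowerSeries.X ^ a ∣ x i) {g : MvPowerSeries ι k}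
    (hg : MvPowerSeries.constantCoeff g = 0) : PowerSeries.X ^ a ∣ evalHom x hx0 g := by
  rw [← mem_orderGE]
  refine evalHom_mem x hx0 _ a (fun f hf => mem_orderGE.2 hf) fun e he => ?_
  rw [mem_orderGE]
  have he0 : e ≠ 0 := by
    rintro rfl
    exact he hg
  obtain ⟨i, hi⟩ := Finsupp.ne_iff.1 he0
  exact ((ha i).trans (dvd_pow_self _ hi)).trans
    (Finset.dvd_prod_of_mem _ (Finsupp.mem_support_iff.2 hi))

/-- If the fraction field of `k⟦x⟧` is `k((t))`, then `k⟦x⟧` contains all series of high order. -/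
theorem exists_X_pow_dvd_imp_mem
    (hfrac : IsFractionRing (curveRing x hx0) (LaurentSeries k)) {i : ι} (hi : x i ≠ 0) :
    ∃ N, ∀ f : k⟦X⟧, PowerSeries.X ^ N ∣ f → f ∈ curveRing x hx0 := by
  obtain ⟨⟨p, q⟩, hpq⟩ := IsLocalization.surj (nonZeroDivisors (curveRing x hx0))
    (algebraMap k⟦X⟧ (LaurentSeries k) PowerSeries.X)
  have hpq' : (PowerSeries.X : k⟦X⟧) * (q.1 : k⟦X⟧) = p := by
    apply IsFractionRing.injective k⟦X⟧ (LaurentSeries k)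
    rw [map_mul]
    exact hpq
  have hq : (q.1 : k⟦X⟧) ≠ 0 := fun h => nonZeroDivisors.coe_ne_zero q (Subtype.ext h)
  set a := (x i).order.toNat
  -- With `t = p / q`, the element `q ^ a` clears the denominators of all module generators `t ^ m`,
  -- `m < a`, over `k⟦x_i⟧`: `q ^ a * t ^ m = p ^ m * q ^ (a - m)`.
  have hQ : ∀ f : k⟦X⟧, (q.1 : k⟦X⟧) ^ a * f ∈ curveRing x hx0 := by
    intro f
    obtain ⟨h, rfl⟩ := exists_eq_sum_evalOne (hx0 i) (PowerSeries.X_pow_order_dvd (φ := x i))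
      (PowerSeries.coeff_order hi) f
    rw [Finset.mul_sum]
    refine Subalgebra.sum_mem _ fun m hm => ?_
    have hm' : m ≤ a := (Finset.mem_range.1 hm).le
    have h1 : (q.1 : k⟦X⟧) ^ a * (evalOne (x i) (hx0 i) (h m) * PowerSeries.X ^ m) =
        evalOne (x i) (hx0 i) (h m) * ((p : k⟦X⟧) ^ m * (q.1 : k⟦X⟧) ^ (a - m)) := by
      rw [← hpq', mul_pow, mul_assoc (PowerSeries.X ^ m), ← pow_add, Nat.add_sub_cancel' hm']
      ring
    rw [h1]
    exact mul_mem (evalOne_mem_curveRing i _) (mul_mem (pow_mem p.2 _) (pow_mem q.1.2 _))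
  refine ⟨((q.1 : k⟦X⟧) ^ a).order.toNat, fun f hf => ?_⟩
  obtain ⟨g, rfl⟩ := (dvd_X_pow_order (pow_ne_zero a hq)).trans hf
  exact hQ g

end CurveRing

section Conductor

variable {R : Subalgebra k k⟦X⟧}

/-- The conductor is stable under `k⟦t⟧`, so an element of least order generates it there. The
hypothesis keeps the `sInf` from being the default value of an empty set. -/
theorem conductorExp_spec (h : ∃ N, ∀ f : k⟦X⟧, PowerSeries.X ^ N ∣ f → f ∈ R) :
    (∀ f : k⟦X⟧, PowerSeries.X ^ conductorExp R ∣ f → f ∈ R) ∧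
      ∀ r : R, r ∈ conductorIdeal R ↔ PowerSeries.X ^ conductorExp R ∣ (r : k⟦X⟧) := by
  obtain ⟨N, hN⟩ := h
  have hne : {m : ℕ | ∃ r ∈ conductorIdeal R, PowerSeries.order (r : k⟦X⟧) = m}.Nonempty :=
    ⟨N, ⟨PowerSeries.X ^ N, hN _ dvd_rfl⟩, fun f => hN _ (dvd_mul_right _ _),
      PowerSeries.order_X_pow N⟩
  obtain ⟨r, hr, hrc⟩ := Nat.sInf_mem hne
  change _ = ((conductorExp R : ℕ) : ℕ∞) at hrc
  have hr0 : (r : k⟦X⟧) ≠ 0 := fun h => by simp [h] at hrc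
  have hdvd := dvd_X_pow_order hr0
  rw [hrc, ENat.toNat_natCast] at hdvd
  have h1 : ∀ f : k⟦X⟧, PowerSeries.X ^ conductorExp R ∣ f → f ∈ R := fun f hf => by
    obtain ⟨g, rfl⟩ := hdvd.trans hf
    exact hr g
  refine ⟨h1, fun p => ⟨fun hp => ?_, fun hp f => h1 _ (hp.mul_right f)⟩⟩
  by_cases hp0 : (p : k⟦X⟧) = 0
  · rw [hp0]; exact dvd_zero _
  · have h2 : conductorExp R ≤ (p : k⟦X⟧).order.toNat :=
      Nat.sInf_le ⟨p, hp, (ENat.natCast_toNat (PowerSeries.order_eq_top.not.2 hp0)).symm⟩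
    exact (pow_dvd_pow _ h2).trans PowerSeries.X_pow_order_dvd

/-- Reduction of a power series of order at least `m` modulo `R` and the monomials whose exponents
are not values of `R`. -/
theorem exists_reduction {c N s : ℕ} (hc : ∀ f : k⟦X⟧, PowerSeries.X ^ c ∣ f → f ∈ R)
    {b : Fin s → ℕ} (hb : ∀ m, N ≤ m → m < c → m ∉ valueSet R → ∃ j, b j = m) {m : ℕ}
    (hm : N ≤ m) {f : k⟦X⟧} (hf : PowerSeries.X ^ m ∣ f) :
    ∃ r ∈ R, PowerSeries.X ^ m ∣ r ∧ ∃ δ : Fin s → k, (∀ l, b l < m → δ l = 0) ∧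
      f = r + ∑ l, δ l • PowerSeries.X ^ b l := by
  classical
  -- The coefficient of degree `m` is removed by an element of `R` of order `m` if `m` is a value,
  -- and by a monomial `X ^ b j` otherwise. From degree `c` on, everything lies in `R`.
  induction hd : c - m generalizing m f with
  | zero =>
    exact ⟨f, hc f ((pow_dvd_pow _ (by omega)).trans hf), hf, 0, fun _ _ => rfl, by simp⟩
  | succ d ih =>
    have hcut : ∀ g : k⟦X⟧, PowerSeries.X ^ m ∣ g → PowerSeries.coeff m g = 0 →
        PowerSeries.X ^ (m + 1) ∣ g := fun g hg h0 => by
      rw [PowerSeries.X_pow_dvd_iff] at hg ⊢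
      intro i hi
      rcases Nat.lt_succ_iff_lt_or_eq.1 hi with h | rfl
      exacts [hg i h, h0]
    by_cases hmv : m ∈ valueSet R
    · obtain ⟨p, hp, hpm⟩ := hmv
      have hp1 : PowerSeries.X ^ m ∣ p := by
        have := PowerSeries.X_pow_order_dvd (φ := p)
        rwa [hpm] at this
      have hp2 : PowerSeries.coeff m p ≠ 0 := ((PowerSeries.order_eq_nat).1 hpm).1
      set e := PowerSeries.coeff m f / PowerSeries.coeff m p
      have hep : PowerSeries.X ^ m ∣ e • p := by
        rw [PowerSeries.smul_eq_C_mul]; exact hp1.mul_left _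
      obtain ⟨r, hr, hrm, δ, hδ, h⟩ := ih (m := m + 1) (f := f - e • p) (by omega)
        (hcut _ (dvd_sub hf hep) (by simp [e, hp2])) (by omega)
      refine ⟨r + e • p, R.add_mem hr (R.smul_mem hp e),
        dvd_add ((pow_dvd_pow _ (Nat.le_succ m)).trans hrm) hep, δ, fun l hl => hδ l (by omega), ?_⟩
      rw [add_right_comm, ← h, sub_add_cancel]
    · obtain ⟨j, hj⟩ := hb m hm (by omega) hmv
      set e := PowerSeries.coeff m f
      have hep : (PowerSeries.X : k⟦X⟧) ^ m ∣ e • PowerSeries.X ^ m := by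
        rw [PowerSeries.smul_eq_C_mul]; exact dvd_mul_left _ _
      obtain ⟨r, hr, hrm, δ, hδ, h⟩ := ih (m := m + 1) (f := f - e • PowerSeries.X ^ m) (by omega)
        (hcut _ (dvd_sub hf hep) (by simp [e])) (by omega)
      refine ⟨r, hr, (pow_dvd_pow _ (Nat.le_succ m)).trans hrm, δ + Pi.single j e,
        fun l hl => ?_, ?_⟩
      · have hlj : l ≠ j := by
          rintro rfl
          omega
        simp [hlj, hδ l (by omega)]
      · simp only [Pi.add_apply, add_smul, Finset.sum_add_distrib, Pi.single_apply, ite_smul,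
          zero_smul, Finset.sum_ite_eq', Finset.mem_univ, if_true, hj]
        rw [← add_assoc, ← h, sub_add_cancel]

/-- Distinct monomials whose exponents are not values of `R` are independent modulo `R`. -/
theorem eq_zero_of_sum_smul_X_pow_mem {s : ℕ} {b : Fin s → ℕ} (hb : StrictMono b)
    (hbR : ∀ j, b j ∉ valueSet R) {μ : Fin s → k}
    (h : ∑ l, μ l • (PowerSeries.X : k⟦X⟧) ^ b l ∈ R) (j : Fin s) : μ j = 0 := by
  induction j using WellFoundedLT.induction with
  | _ j ih =>
    by_contra hj
    -- If `μ j` were the first nonzero coefficient, the sum would be an element of `R` of order `b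
    -- j`.
    refine hbR j ⟨_, h, PowerSeries.order_eq_nat.2 ⟨?_, fun i hi => ?_⟩⟩
    · simpa [PowerSeries.coeff_X_pow, hb.injective.eq_iff] using hj
    · rw [map_sum]
      refine Finset.sum_eq_zero fun l _ => ?_
      rcases lt_or_ge l j with hl | hl
      · simp [ih l hl]
      · have : i ≠ b l := (hi.trans_le (hb.monotone hl)).ne
        simp [PowerSeries.coeff_X_pow, this]

end Conductor

/-! ### Minimal generators -/

section EmbeddingDimension

/-- Minimal generators of the maximal ideal are independent modulo its square. -/
theorem isUnit_coeff_notMem_sq {A : Type*} [CommRing A] [IsLocalRing A] {n : ℕ} (x : Fin n → A)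
    (hspan : IsLocalRing.maximalIdeal A = Ideal.span (Set.range x))
    (hn : (IsLocalRing.maximalIdeal A).spanFinrank = n) {c : Fin n → A}
    (h : ∑ i, c i * x i ∈ IsLocalRing.maximalIdeal A ^ 2) (i : Fin n) : ¬ IsUnit (c i) := by
  classical
  intro hi
  set m := IsLocalRing.maximalIdeal A with hm
  set J : Ideal A := Ideal.span (((Finset.univ.erase i).image x : Finset A) : Set A) with hJ
  have hfg : m.FG := by
    rw [hspan]
    exact ⟨Finset.univ.image x, by simp⟩
  have hxJ : ∀ j, j ≠ i → x j ∈ J := fun j hj => Ideal.subset_span (by simpa using ⟨j, hj, rfl⟩)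
  -- A unit coefficient allows solving for `x i` modulo `m ^ 2`; Nakayama then yields `n - 1`
  -- generators of `m`, too few.
  have hle : m ≤ J ⊔ m • m := by
    conv_lhs => rw [hspan]
    rw [Ideal.span_le]
    rintro _ ⟨j, rfl⟩
    by_cases hj : j = i
    · subst hj
      obtain ⟨u, hu⟩ := hi
      have h1 : x j = ↑u⁻¹ * ∑ l, c l * x l - ↑u⁻¹ * ∑ l ∈ Finset.univ.erase j, c l * x l := by
        rw [← mul_sub, ← Finset.add_sum_erase _ _ (Finset.mem_univ j), add_sub_cancel_right, ← hu,
          Units.inv_mul_cancel_left]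
      rw [SetLike.mem_coe, h1, sub_eq_add_neg, add_comm]
      refine Submodule.add_mem_sup (neg_mem (J.mul_mem_left _ (J.sum_mem fun l hl =>
        J.mul_mem_left _ (hxJ l (Finset.ne_of_mem_erase hl))))) ?_
      rw [smul_eq_mul, ← sq]
      exact Ideal.mul_mem_left _ _ h
    · exact Submodule.mem_sup_left (hxJ j hj)
  have hmJ : m ≤ J := Submodule.le_of_le_smul_of_le_jacobson_bot hfg
    (IsLocalRing.maximalIdeal_le_jacobson _) hle
  have hJm : J ≤ m := by
    rw [hJ, Ideal.span_le, hspan]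
    refine subset_trans ?_ Ideal.subset_span
    simp
  have h2 : m.spanFinrank ≤ (((Finset.univ.erase i).image x : Finset A) : Set A).ncard := by
    rw [le_antisymm hmJ hJm]
    exact Submodule.spanFinrank_span_le_ncard_of_finite (Finset.finite_toSet _)
  rw [Set.ncard_coe_finset, hn] at h2
  have h3 := h2.trans Finset.card_image_le
  rw [Finset.card_erase_of_mem (Finset.mem_univ i), Finset.card_univ, Fintype.card_fin] at h3
  have := i.pos
  omega

end EmbeddingDimension

/-! ### The ring `S` and its minimal presentation -/

section Extension

variable {n s : ℕ} {x : Fin n → k⟦X⟧} {hx0 : ∀ i, PowerSeries.constantCoeff (x i) = 0}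
  {T : Fin s → k⟦X⟧} (hy : ∀ i, PowerSeries.constantCoeff ((Sum.elim x T : _ → k⟦X⟧) i) = 0)

/-- The power series in the `x i` and `T j` form the ring `R[T_1, …, T_s]` if `R` contains all
power series of high order. -/
theorem evalHom_range_eq_adjoin {c : ℕ}
    (hc : ∀ f : k⟦X⟧, PowerSeries.X ^ c ∣ f → f ∈ curveRing x hx0) :
    (evalHom (Sum.elim x T) hy).range =
      (Algebra.adjoin (curveRing x hx0) (Set.range T)).restrictScalars k := by
  set A := (Algebra.adjoin (curveRing x hx0) (Set.range T)).restrictScalars k with hA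
  have hRA : ∀ r ∈ curveRing x hx0, r ∈ A := fun r hr =>
    (Algebra.adjoin (curveRing x hx0) (Set.range T)).algebraMap_mem ⟨r, hr⟩
  have hTA : ∀ j, T j ∈ A := fun j =>
    Algebra.subset_adjoin (R := curveRing x hx0) (Set.mem_range_self (f := T) j)
  have hyA : ∀ i, (Sum.elim x T : _ → k⟦X⟧) i ∈ A := by
    rintro (i | j)
    exacts [hRA _ (self_mem_curveRing i), hTA j]
  refine le_antisymm ?_ fun f hf => ?_
  · rintro _ ⟨g, rfl⟩
    refine evalHom_mem (Sum.elim x T) hy (Subalgebra.toSubmodule A) c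
      (fun f hf => hRA f (hc f hf)) fun e _ => ?_
    exact Subalgebra.prod_mem A fun i _ => pow_mem (hyA i) _
  · have hRB : ∀ r ∈ curveRing x hx0, r ∈ (evalHom (Sum.elim x T) hy).range := by
      rintro _ ⟨g, rfl⟩
      exact ⟨MvPowerSeries.rename Sum.inl g, evalHom_rename _ hy Sum.inl g⟩
    have hTB : ∀ j, T j ∈ (evalHom (Sum.elim x T) hy).range := fun j =>
      ⟨MvPowerSeries.X (Sum.inr j), evalHom_X _ hy _⟩
    generalize (evalHom (Sum.elim x T) hy).range = B at hRB hTB ⊢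
    rw [hA, Subalgebra.mem_restrictScalars] at hf
    induction hf using Algebra.adjoin_induction with
    | mem f h => obtain ⟨j, rfl⟩ := h; exact hTB j
    | algebraMap r => exact hRB r r.2
    | add f g _ _ h h' => exact B.add_mem h h'
    | mul f g _ _ h h' => exact B.mul_mem h h'

/-- `R[𝔠_R / x] = R[t^{b_1}, …, t^{b_s}]`. -/
theorem conductorExtension_eq_adjoin {R : Subalgebra k k⟦X⟧} {c a : ℕ} {z : k⟦X⟧}
    (hza : Associated (PowerSeries.X ^ a) z) (hac : a ≤ c)
    (hc : ∀ f : k⟦X⟧, PowerSeries.X ^ c ∣ f → f ∈ R)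
    (hcI : ∀ r : R, r ∈ conductorIdeal R ↔ PowerSeries.X ^ c ∣ (r : k⟦X⟧))
    {b : Fin s → ℕ} (hb : ∀ m, c - a ≤ m → m < c → m ∉ valueSet R → ∃ j, b j = m)
    (hb' : ∀ j, c ≤ b j + a) :
    conductorExtension R z = (Algebra.adjoin R
      (Set.range fun j => (PowerSeries.X ^ b j : k⟦X⟧))).restrictScalars k := by
  have h : Algebra.adjoin R {y : k⟦X⟧ | ∃ r ∈ conductorIdeal R, z * y = r} =
      Algebra.adjoin R (Set.range fun j => (PowerSeries.X ^ b j : k⟦X⟧)) := by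
    refine le_antisymm (Algebra.adjoin_le ?_) (Algebra.adjoin_le ?_)
    · rintro y ⟨r, hr, hzy⟩
      have h1 : PowerSeries.X ^ (c - a) ∣ y := by
        rw [hcI, ← hzy] at hr
        have h2 : PowerSeries.X ^ c ∣ PowerSeries.X ^ a * y :=
          hr.trans (mul_dvd_mul_right hza.symm.dvd y)
        rw [← Nat.add_sub_cancel' hac, pow_add] at h2
        exact (mul_dvd_mul_iff_left (pow_ne_zero _ PowerSeries.X_ne_zero)).1 h2
      obtain ⟨p, hp, -, δ, -, rfl⟩ := exists_reduction hc hb le_rfl h1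
      refine add_mem (Subalgebra.algebraMap_mem _ (⟨p, hp⟩ : R))
        (Subalgebra.sum_mem _ fun l _ => ?_)
      have h3 : δ l • (PowerSeries.X : k⟦X⟧) ^ b l =
          (algebraMap k R (δ l)) • (PowerSeries.X : k⟦X⟧) ^ b l := (algebraMap_smul R _ _).symm
      rw [h3]
      exact Subalgebra.smul_mem _ (Algebra.subset_adjoin (Set.mem_range_self l)) _
    · rintro _ ⟨j, rfl⟩
      have h1 : PowerSeries.X ^ c ∣ z * PowerSeries.X ^ b j := by
        refine (pow_dvd_pow _ (hb' j)).trans ?_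
        rw [add_comm, pow_add]
        exact mul_dvd_mul_right hza.dvd _
      exact Algebra.subset_adjoin ⟨(⟨_, hc _ h1⟩ : R), (hcI _).2 h1, rfl⟩
  rw [conductorExtension, h]

/-- The image in `k⟦t⟧` of an ideal of a subalgebra. -/
def idealImage {R : Subalgebra k k⟦X⟧} (I : Ideal R) : Submodule k k⟦X⟧ :=
  (I.restrictScalars k).map R.val.toLinearMap

theorem mem_idealImage {R : Subalgebra k k⟦X⟧} {I : Ideal R} {f : k⟦X⟧} :
    f ∈ idealImage I ↔ ∃ h : f ∈ R, (⟨f, h⟩ : R) ∈ I :=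
  ⟨by rintro ⟨r, hr, rfl⟩; exact ⟨r.2, hr⟩, fun ⟨h, hI⟩ => ⟨⟨f, h⟩, hI, rfl⟩⟩

theorem maximalIdeal_eq_span {c a : ℕ} (i₀ : Fin n)
    (hx : Associated (PowerSeries.X ^ a) (x i₀))
    (hc : ∀ f : k⟦X⟧, PowerSeries.X ^ c ∣ f → f ∈ curveRing x hx0) :
    IsLocalRing.maximalIdeal (curveRing x hx0) =
      Ideal.span (Set.range fun i => (⟨x i, self_mem_curveRing i⟩ : curveRing x hx0)) := by
  refine le_antisymm (fun r hr => ?_) (Ideal.span_le.2 ?_)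
  · set I := Ideal.span (Set.range fun i => (⟨x i, self_mem_curveRing i⟩ : curveRing x hx0))
    obtain ⟨f, g, rfl⟩ := r
    have hg : MvPowerSeries.constantCoeff g = 0 := by
      rw [mem_maximalIdeal_curveRing] at hr
      rw [← constantCoeff_evalHom x hx0]
      exact hr
    suffices h : evalHom x hx0 g ∈ idealImage I by
      obtain ⟨_, h'⟩ := mem_idealImage.1 h
      exact h'
    -- The bound `c + a` leaves room to divide a tail by `x i₀` with quotient of order at least `c`,
    -- hence in `R`.
    refine evalHom_mem x hx0 _ (c + a) (fun f hf => ?_) fun e he => ?_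
    · rw [add_comm, pow_add] at hf
      obtain ⟨q, rfl⟩ := (mul_dvd_mul_right hx.symm.dvd _).trans hf
      refine ⟨⟨x i₀, self_mem_curveRing i₀⟩ * ⟨PowerSeries.X ^ c * q, hc _ (dvd_mul_right _ _)⟩,
        I.mul_mem_right _ (Ideal.subset_span ⟨i₀, rfl⟩), (mul_assoc _ _ _).symm⟩
    · have he0 : e ≠ 0 := by
        rintro rfl
        exact he hg
      obtain ⟨i, hi⟩ := Finsupp.ne_iff.1 he0
      have h1 : (e.prod fun i m => (⟨x i, self_mem_curveRing i⟩ : curveRing x hx0) ^ m) ∈ I :=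
        I.mem_of_dvd (Finset.dvd_prod_of_mem _ (Finsupp.mem_support_iff.2 hi))
          (I.pow_mem_of_mem (Ideal.subset_span ⟨i, rfl⟩) _ (Nat.pos_of_ne_zero hi))
      exact ⟨_, h1, by simp [Finsupp.prod]⟩
  · rintro _ ⟨i, rfl⟩
    exact mem_maximalIdeal_curveRing.2 (hx0 i)

/-- The kernel of the presentation by the `x i` and `T j` consists of series of order at least two,
that is, this presentation is minimal. -/
theorem constantCoeff_pderiv_eq_zero_of_evalHom_eq_zero {c a : ℕ} (i₀ : Fin n)
    (hxi₀ : Associated (PowerSeries.X ^ a) (x i₀)) (hxa : ∀ i, PowerSeries.X ^ a ∣ x i)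
    (hac : 2 * a ≤ c)
    (hc : ∀ f : k⟦X⟧, PowerSeries.X ^ c ∣ f → f ∈ curveRing x hx0)
    (hcI : ∀ r : curveRing x hx0, PowerSeries.X ^ c ∣ (r : k⟦X⟧) →
      r ∈ IsLocalRing.maximalIdeal (curveRing x hx0) ^ 2)
    (hedim : (IsLocalRing.maximalIdeal (curveRing x hx0)).spanFinrank = n)
    {b : Fin s → ℕ} (hbm : StrictMono b) (hbR : ∀ j, b j ∉ valueSet (curveRing x hx0))
    (hb' : ∀ j, c ≤ b j + a) (hT : T = fun j => PowerSeries.X ^ b j)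
    {g : MvPowerSeries (Fin n ⊕ Fin s) k} (hg : evalHom (Sum.elim x T) hy g = 0) :
    MvPowerSeries.constantCoeff g = 0 ∧
      ∀ u, MvPowerSeries.constantCoeff (MvPowerSeries.pderiv k u g) = 0 := by
  classical
  set y : Fin n ⊕ Fin s → k⟦X⟧ := Sum.elim x T with hydef
  set m := IsLocalRing.maximalIdeal (curveRing x hx0)
  have hg0 : MvPowerSeries.constantCoeff g = 0 := by
    rw [← constantCoeff_evalHom y hy, hg, map_zero]
  refine ⟨hg0, ?_⟩
  have hTb : ∀ j, PowerSeries.X ^ (c - a) ∣ T j := fun j => by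
    rw [hT]
    exact pow_dvd_pow _ (by have := hb' j; omega)
  have hya : ∀ i, PowerSeries.X ^ a ∣ y i := by
    rintro (i | j)
    · exact hxa i
    · exact (pow_dvd_pow _ (by omega)).trans (hTb j)
  set L : k⟦X⟧ := ∑ u, MvPowerSeries.coeff (Finsupp.single u 1) g • y u with hL
  -- the part of `g` of degree at least two
  have hW : evalHom y hy (g - ∑ u, MvPowerSeries.coeff (Finsupp.single u 1) g •
      MvPowerSeries.X u) ∈ idealImage (m ^ 2) := by
    refine evalHom_mem y hy _ c
      (fun f hf => mem_idealImage.2 ⟨hc f hf, hcI ⟨f, hc f hf⟩ hf⟩) fun e he => ?_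
    have hsplit : ∀ (e : Fin n ⊕ Fin s →₀ ℕ) u, e u ≠ 0 →
        e = Finsupp.single u 1 + (e - Finsupp.single u 1) := fun e u hu => by
      rw [add_tsub_cancel_of_le]
      exact Finsupp.single_le_iff.2 (Nat.one_le_iff_ne_zero.2 hu)
    have hprod : ∀ u (e : Fin n ⊕ Fin s →₀ ℕ), ((Finsupp.single u 1 + e).prod fun i m => y i ^ m) =
        y u * e.prod fun i m => y i ^ m := fun u e => by
      rw [Finsupp.prod_add_index' (fun _ => pow_zero _) (fun _ _ _ => pow_add _ _ _)]
      congr 1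
      simp
    have he0 : e ≠ 0 := by
      rintro rfl
      apply he
      simp [hg0]
    -- The linear terms of `g` have been subtracted, so no surviving exponent is a single variable.
    have he1 : ∀ u, e - Finsupp.single u 1 ≠ 0 ∨ e u = 0 := by
      intro u
      by_contra! h
      have h1 := hsplit e u h.2
      rw [h.1, add_zero] at h1
      apply he
      rw [h1, map_sub, map_sum, Finset.sum_eq_single u]
      · simp
      · intro w _ hw
        simp [MvPowerSeries.coeff_X, Finsupp.single_left_inj, hw.symm]
      · simp
    have hdvd : ∀ e : Fin n ⊕ Fin s →₀ ℕ, e ≠ 0 →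
        PowerSeries.X ^ a ∣ e.prod fun i m => y i ^ m := fun e he => by
      obtain ⟨i, hi⟩ := Finsupp.ne_iff.1 he
      exact ((hya i).trans (dvd_pow_self _ hi)).trans
        (Finset.dvd_prod_of_mem (fun i => y i ^ e i) (Finsupp.mem_support_iff.2 hi))
    -- A monomial containing `T_l` has order at least `(c - a) + a = c`, so it lies in the
    -- conductor. A monomial in the `x` variables alone is a product of two elements of `m`.
    by_cases hinr : ∃ l, e (Sum.inr l) ≠ 0
    · obtain ⟨l, hl⟩ := hinr
      have h1 : PowerSeries.X ^ c ∣ e.prod fun i m => y i ^ m := by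
        rw [hsplit e _ hl, hprod, ← Nat.sub_add_cancel (show a ≤ c by omega), pow_add]
        exact mul_dvd_mul (hTb l) (hdvd _ ((he1 _).resolve_right hl))
      exact mem_idealImage.2 ⟨hc _ h1, hcI ⟨_, hc _ h1⟩ h1⟩
    · push Not at hinr
      obtain ⟨u, hu⟩ := Finsupp.ne_iff.1 he0
      rcases u with i | l
      · have hne := (he1 (Sum.inl i)).resolve_right hu
        set e' := e - Finsupp.single (Sum.inl i) 1
        have hR : (e'.prod fun i m => y i ^ m) ∈ curveRing x hx0 := by
          refine Subalgebra.prod_mem _ fun w hw => ?_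
          rcases w with w | w
          · exact pow_mem (self_mem_curveRing w) _
          · exact absurd hw (by simp [e', hinr w])
        have hm' : (⟨_, hR⟩ : curveRing x hx0) ∈ m := by
          rw [mem_maximalIdeal_curveRing]
          obtain ⟨w, hw⟩ := Finsupp.ne_iff.1 hne
          have h1 : PowerSeries.X ∣ e'.prod fun i m => y i ^ m :=
            ((PowerSeries.X_dvd_iff.2 (hy w)).trans (dvd_pow_self _ hw)).trans
              (Finset.dvd_prod_of_mem (fun i => y i ^ e' i) (Finsupp.mem_support_iff.2 hw))
          exact PowerSeries.X_dvd_iff.1 h1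
        rw [hsplit e _ hu, hprod]
        have hxm : (⟨x i, self_mem_curveRing i⟩ : curveRing x hx0) ∈ m :=
          mem_maximalIdeal_curveRing.2 (hx0 i)
        refine mem_idealImage.2 ⟨mul_mem (self_mem_curveRing i) hR, ?_⟩
        rw [sq]
        exact Ideal.mul_mem_mul hxm hm'
      · exact absurd (hinr l) hu
  have hLm : L ∈ idealImage (m ^ 2) := by
    have h1 := Submodule.neg_mem _ hW
    rw [map_sub, hg, zero_sub, neg_neg, map_sum] at h1
    simpa only [map_smul, evalHom_X] using h1
  obtain ⟨hLR, hLm⟩ := mem_idealImage.1 hLm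
  have hxsum : ∑ i, MvPowerSeries.coeff (Finsupp.single (Sum.inl i) 1) g • x i ∈ curveRing x hx0 :=
    sum_mem fun i _ => Subalgebra.smul_mem _ (self_mem_curveRing i) _
  have hLsplit : L = ∑ i, MvPowerSeries.coeff (Finsupp.single (Sum.inl i) 1) g • x i +
      ∑ l, MvPowerSeries.coeff (Finsupp.single (Sum.inr l) 1) g • T l := by
    rw [hL, Fintype.sum_sum_type]
    rfl
  have hμ : ∀ l, MvPowerSeries.coeff (Finsupp.single (Sum.inr l) 1) g = 0 := by
    refine eq_zero_of_sum_smul_X_pow_mem hbm hbR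
      (μ := fun l => MvPowerSeries.coeff (Finsupp.single (Sum.inr l) 1) g) ?_
    have h1 := sub_mem hLR hxsum
    rw [hLsplit, add_sub_cancel_left, hT] at h1
    exact h1
  have hlin : ∀ i, MvPowerSeries.coeff (Finsupp.single (Sum.inl i) 1) g = 0 := by
    intro i
    by_contra hi
    refine isUnit_coeff_notMem_sq
      (fun i => (⟨x i, self_mem_curveRing i⟩ : curveRing x hx0))
      (maximalIdeal_eq_span i₀ hxi₀ hc) hedim
      (c := fun i => algebraMap k _ (MvPowerSeries.coeff (Finsupp.single (Sum.inl i) 1) g)) ?_ i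
      ((isUnit_iff_ne_zero.2 hi).map _)
    convert hLm using 1
    apply Subtype.ext
    refine Eq.trans ?_ hLsplit.symm
    simp [hμ, Algebra.smul_def]
  rintro (i | l)
  · rw [constantCoeff_pderiv, hlin]
  · rw [constantCoeff_pderiv, hμ]

end Extension

theorem card_pairs_lt (s : ℕ) : Fintype.card {p : Fin s × Fin s // p.1 < p.2} = s.choose 2 := by
  rw [Fintype.card_subtype, Finset.card_filter, Fintype.sum_prod_type_right]
  have h : ∀ j : Fin s, ∑ i : Fin s, (if i < j then 1 else 0) = (j : ℕ) := fun j => by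
    rw [← Finset.card_filter, Finset.filter_gt_eq_Iio, Fin.card_Iio]
  simp only [h]
  rw [Fin.sum_univ_eq_sum_range (fun i => i), Finset.sum_range_id, Nat.choose_two_right]

end CurveTorsion

end

/-! ### The main theorem -/

theorem mainTheorem5 {k : Type*} [Field k] [IsAlgClosed k] [CharZero k]
    {n s : ℕ} [NeZero n]
    -- the generators `x_i = α_i t^{a_i}` of `R = k⟦x_1, …, x_n⟧`
    (x : Fin n → PowerSeries k) (a : Fin n → ℕ) (α : Fin n → (PowerSeries k)ˣ)
    (hx : ∀ i, x i = (α i : PowerSeries k) * PowerSeries.X ^ a i)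
    (hx0 : ∀ i, PowerSeries.constantCoeff (x i) = 0)
    (ha : StrictMono a)
    -- `R` has embedding dimension `n`
    (hedim : (IsLocalRing.maximalIdeal (CurveTorsion.curveRing x hx0)).spanFinrank = n)
    -- the fraction field of `R` is `k((t))`, so that the integral closure of `R` is `k⟦t⟧`
    (hfrac : IsFractionRing (CurveTorsion.curveRing x hx0) (LaurentSeries k))
    -- the conductor of `R` lies in the square of the maximal ideal
    (hcond : CurveTorsion.conductorIdeal (CurveTorsion.curveRing x hx0) ≤
      IsLocalRing.maximalIdeal (CurveTorsion.curveRing x hx0) ^ 2)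
    -- `b_1 < … < b_s` are the elements of `[c_R - a_1, c_R - 1]` outside `v(R)`
    (b : Fin s → ℕ) (hb : StrictMono b)
    (hbrange : Set.range b =
      {m | CurveTorsion.conductorExp (CurveTorsion.curveRing x hx0) ≤ m + a 0 ∧
        m < CurveTorsion.conductorExp (CurveTorsion.curveRing x hx0) ∧
        m ∉ CurveTorsion.valueSet (CurveTorsion.curveRing x hx0)})
    -- `S = R[𝔠_R / x_1]`
    (S : Subalgebra k (PowerSeries k))
    (hS : S = CurveTorsion.conductorExtension (CurveTorsion.curveRing x hx0) (x 0)) :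
    -- `S = R[T_1, …, T_s]` with `T_j = t^{b_j}`
    S = (Algebra.adjoin (CurveTorsion.curveRing x hx0)
      (Set.range fun j => (PowerSeries.X ^ b j : PowerSeries k))).restrictScalars k ∧
    -- the presentation `S = k⟦X_1, …, X_n, T_1, …, T_s⟧ / ker Φ` used for `Ω_S`
    ∃ Φ : MvPowerSeries (Fin n ⊕ Fin s) k →ₐ[k] S,
      (∀ i, (Φ (MvPowerSeries.X (Sum.inl i)) : PowerSeries k) = x i) ∧
      (∀ j, (Φ (MvPowerSeries.X (Sum.inr j)) : PowerSeries k) = PowerSeries.X ^ b j) ∧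
      Function.Surjective Φ ∧
      ((n * s + s.choose 2 : ℕ) : ℕ∞) ≤
        Module.length S (Submodule.torsion S (CurveTorsion.Omega Φ)) ∧
      ∃ (f : Fin n → Fin s → MvPowerSeries (Fin n) k) (δ : Fin n → Fin s → Fin s → k),
        (∀ i j, MvPowerSeries.constantCoeff (f i j) = 0) ∧
        (∀ i j l, l ≤ j → δ i j l = 0) ∧
        (∀ i j, CurveTorsion.bracket Φ a b i j (f i j) (δ i j) ∈
          Submodule.torsion S (CurveTorsion.Omega Φ)) ∧
        (∀ i j, CurveTorsion.Gam Φ b i j ∈ Submodule.torsion S (CurveTorsion.Omega Φ)) ∧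
        LinearIndependent k
          (Sum.elim
            (fun p : Fin n × Fin s =>
              CurveTorsion.bracket Φ a b p.1 p.2 (f p.1 p.2) (δ p.1 p.2))
            (fun p : {p : Fin s × Fin s // p.1 < p.2} =>
              CurveTorsion.Gam Φ b p.1.1 p.1.2)) := by
  classical
  set R := CurveTorsion.curveRing x hx0
  set c := CurveTorsion.conductorExp R with hcdef
  have hassoc : ∀ i, Associated (PowerSeries.X ^ a i) (x i) := fun i =>
    ⟨α i, by rw [hx, mul_comm]⟩
  have hxne : ∀ i, x i ≠ 0 := fun i h =>
    pow_ne_zero (a i) PowerSeries.X_ne_zero ((hassoc i).eq_zero_iff.2 h)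
  have hane : ∀ i, a i ≠ 0 := fun i h => by
    have h1 := hx0 i
    rw [hx, h, pow_zero, mul_one] at h1
    exact ((α i).isUnit.map PowerSeries.constantCoeff).ne_zero h1
  have hxa : ∀ i, PowerSeries.X ^ a 0 ∣ x i := fun i =>
    (pow_dvd_pow _ (ha.monotone (Fin.zero_le i))).trans (hassoc i).dvd
  obtain ⟨hc, hcI⟩ := CurveTorsion.conductorExp_spec
    (CurveTorsion.exists_X_pow_dvd_imp_mem hfrac (hxne 0))
  rw [← hcdef] at hc hcI
  have hcm : ∀ r : R, PowerSeries.X ^ c ∣ (r : PowerSeries k) →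
      r ∈ IsLocalRing.maximalIdeal R ^ 2 := fun r hr => hcond ((hcI r).2 hr)
  -- Elements of the maximal ideal have order at least `a 0`, and `X ^ c` lies in its square.
  have hac : 2 * a 0 ≤ c := by
    have h1 : IsLocalRing.maximalIdeal R ≤
        (Ideal.span {(PowerSeries.X : PowerSeries k) ^ a 0}).comap R.val := by
      rintro ⟨_, g, rfl⟩ hr
      rw [CurveTorsion.mem_maximalIdeal_curveRing] at hr
      refine Ideal.mem_span_singleton.2 (CurveTorsion.evalHom_mem_orderGE (hx0 := hx0) hxa ?_)
      rw [← CurveTorsion.constantCoeff_evalHom x hx0]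
      exact hr
    have h2 := Ideal.le_comap_pow R.val 2
      (Ideal.pow_right_mono h1 2 (hcm ⟨PowerSeries.X ^ c, hc _ dvd_rfl⟩ dvd_rfl))
    rw [Ideal.mem_comap, Ideal.span_singleton_pow, Ideal.mem_span_singleton, ← pow_mul] at h2
    rw [mul_comm]
    exact (pow_dvd_pow_iff PowerSeries.X_ne_zero PowerSeries.X_prime.not_isUnit).1 h2
  have hbmem : ∀ j, c ≤ b j + a 0 ∧ b j < c ∧ b j ∉ CurveTorsion.valueSet R := fun j => by
    have h1 : b j ∈ Set.range b := ⟨j, rfl⟩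
    rwa [hbrange] at h1
  have hb0 : ∀ j, b j ≠ 0 := fun j => by
    have h1 := (hbmem j).1
    have h2 := hane 0
    omega
  have hbsurj : ∀ m, c - a 0 ≤ m → m < c → m ∉ CurveTorsion.valueSet R → ∃ j, b j = m := by
    intro m h1 h2 h3
    have h4 : m ∈ Set.range b := by
      rw [hbrange]
      exact ⟨by omega, h2, h3⟩
    exact h4
  have hSadj := hS.trans (CurveTorsion.conductorExtension_eq_adjoin (hassoc 0)
    (by omega : a 0 ≤ c) hc hcI hbsurj fun j => (hbmem j).1)
  refine ⟨hSadj, ?_⟩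
  obtain ⟨T, hT⟩ : ∃ T : Fin s → PowerSeries k, T = fun j => PowerSeries.X ^ b j := ⟨_, rfl⟩
  rw [← hT] at hSadj
  have hy : ∀ i, PowerSeries.constantCoeff ((Sum.elim x T : _ → PowerSeries k) i) = 0 := by
    rintro (i | j)
    · exact hx0 i
    · simp [hT, hb0 j]
  have hrange : (CurveTorsion.evalHom (Sum.elim x T) hy).range = S :=
    by
    rw [hSadj]
    exact CurveTorsion.evalHom_range_eq_adjoin hy hc
  obtain ⟨Φ, hΦy⟩ : ∃ Φ : MvPowerSeries (Fin n ⊕ Fin s) k →ₐ[k] S,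
      ∀ g, (Φ g : PowerSeries k) = CurveTorsion.evalHom (Sum.elim x T) hy g :=
    ⟨(CurveTorsion.evalHom (Sum.elim x T) hy).codRestrict S fun g => hrange ▸ ⟨g, rfl⟩,
      fun _ => rfl⟩
  have hΦ : Function.Surjective Φ := fun f => by
    have h1 : (f : PowerSeries k) ∈ (CurveTorsion.evalHom (Sum.elim x T) hy).range :=
      hrange ▸ f.2
    obtain ⟨g, hg⟩ := h1
    exact ⟨g, Subtype.ext ((hΦy g).trans hg)⟩
  have hker : ∀ g, Φ g = 0 → MvPowerSeries.constantCoeff g = 0 ∧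
      ∀ u, MvPowerSeries.constantCoeff (MvPowerSeries.pderiv k u g) = 0 := fun g hg =>
    CurveTorsion.constantCoeff_pderiv_eq_zero_of_evalHom_eq_zero hy 0 (hassoc 0) hxa hac hc hcm
      hedim hb (fun j => (hbmem j).2.2) (fun j => (hbmem j).1) hT
      (by rw [← hΦy, hg, ZeroMemClass.coe_zero])
  -- The remainder `w - X ^ b j` has order at least `b j + 1`; reducing it from that degree on makes
  -- `δ l` vanish for `l ≤ j`.
  have hlift : ∀ i j, ∃ (f : MvPowerSeries (Fin n) k) (δ : Fin s → k) (w : PowerSeries k),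
      MvPowerSeries.constantCoeff f = 0 ∧ (∀ l, l ≤ j → δ l = 0) ∧
      w = T j + CurveTorsion.evalHom x hx0 f + ∑ l, δ l • T l ∧
      (b j : PowerSeries k) * w * PowerSeries.derivative k (x i) =
        (a i : PowerSeries k) * x i * PowerSeries.derivative k w := by
    intro i j
    obtain ⟨w, hw1, hw2⟩ := CurveTorsion.exists_logDerivative_eq (α i) (hane i) (b j)
    subst hT
    obtain ⟨_, ⟨f, rfl⟩, hrm, δ, hδ, h⟩ := CurveTorsion.exists_reduction hc hbsurj
      (by have := (hbmem j).1; omega : c - a 0 ≤ b j + 1) hw1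
    refine ⟨f, δ, w, ?_, fun l hl => hδ l (Nat.lt_succ_of_le (hb.monotone hl)), ?_, ?_⟩
    · rw [← CurveTorsion.constantCoeff_evalHom x hx0]
      exact PowerSeries.X_dvd_iff.1 ((dvd_pow_self _ (Nat.succ_ne_zero _)).trans hrm)
    · rw [add_assoc]
      exact eq_add_of_sub_eq' h
    · rw [hx]
      exact hw2
  choose f δ w hf hδ hw hwd using hlift
  have hbr : ∀ i j, CurveTorsion.bracket Φ a b i j (f i j) (δ i j) ∈
      Submodule.torsion S (CurveTorsion.Omega Φ) := fun i j =>
    CurveTorsion.bracket_mem_torsion hΦ hΦy (hxne 0) a b i j _ _ (hw i j) (hwd i j)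
  have hGam : ∀ i j, CurveTorsion.Gam Φ b i j ∈
      Submodule.torsion S (CurveTorsion.Omega Φ) := fun i j =>
    CurveTorsion.Gam_mem_torsion hΦ hΦy (hxne 0) b i j (by
      subst hT
      have h1 : ∀ m : ℕ, m ≠ 0 → PowerSeries.X * PowerSeries.derivative k (PowerSeries.X ^ m) =
          (m : PowerSeries k) * PowerSeries.X ^ m := fun m hm => by
        rw [PowerSeries.derivative_pow, PowerSeries.derivative_X, mul_one, mul_left_comm,
          mul_pow_sub_one hm]
      refine mul_left_cancel₀ (PowerSeries.X_ne_zero (R := k)) ?_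
      linear_combination ((b j : PowerSeries k) * PowerSeries.X ^ b j) * h1 (b i) (hb0 i) -
        ((b i : PowerSeries k) * PowerSeries.X ^ b i) * h1 (b j) (hb0 j))
  have hrel := CurveTorsion.constantCoeff_eq_zero_of_relation Φ hΦ hker (a := a) hb0 hf hδ
  refine ⟨Φ, fun i => (hΦy _).trans (CurveTorsion.evalHom_X _ hy _),
    fun j => ((hΦy _).trans (CurveTorsion.evalHom_X _ hy _)).trans (congrFun hT j), hΦ,
    ?_, f, δ, hf, hδ, hbr, hGam, ?_⟩
  · let ω : (Fin n × Fin s) ⊕ {p : Fin s × Fin s // p.1 < p.2} →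
        Submodule.torsion S (CurveTorsion.Omega Φ) :=
      Sum.elim (fun p => ⟨_, hbr p.1 p.2⟩) (fun p => ⟨_, hGam p.1.1 p.1.2⟩)
    have hcard : Fintype.card ((Fin n × Fin s) ⊕ {p : Fin s × Fin s // p.1 < p.2}) =
        n * s + s.choose 2 := by
      rw [Fintype.card_sum, Fintype.card_prod, Fintype.card_fin, Fintype.card_fin,
        CurveTorsion.card_pairs_lt]
    rw [← hcard]
    refine CurveTorsion.card_le_length
      (I := RingHom.ker ((PowerSeries.constantCoeff (R := k)).comp S.val.toRingHom))
      (RingHom.ker_ne_top _) ω fun t ht p => ?_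
    choose σ hσ using fun p => hΦ (t p)
    have h1 := hrel σ (by
      have h2 := congrArg (Submodule.subtype _) ht
      rw [map_sum, map_zero] at h2
      rw [← h2]
      refine Finset.sum_congr rfl fun p _ => ?_
      rw [hσ]
      rcases p with p | p <;> rfl) p
    rw [RingHom.mem_ker, ← hσ p]
    exact (congrArg PowerSeries.constantCoeff (hΦy _)).trans
      ((CurveTorsion.constantCoeff_evalHom _ hy _).trans h1)
  · rw [Fintype.linearIndependent_iff]
    intro t ht p
    -- A scalar relation is a relation over `S` with constant coefficients, which equal their
    -- constant terms.
    have h1 := hrel (fun p => MvPowerSeries.C (t p)) (by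
      rw [← ht]
      refine Finset.sum_congr rfl fun p _ => ?_
      rw [CurveTorsion.map_C_eq_algebraMap, algebraMap_smul]) p
    simpa using h1
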